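/- Let $A$ be a (not necessarily unital) complex $C^*$-algebra. An associative Hilbert $C^*$-bimodule over $A$ is a Banach space $M$ such that: (1) $M$ is a left and a right $A$-module with $(am)b=a(mb)$, and both actions are non-degenerate; (2) $M$ is a left Hilbert $C^*$-module with respect to an inner product ${}_A\langle\cdot,\cdot\rangle$ and a right Hilbert $C^*$-module with respect to an inner product $\langle\cdot,\cdot\rangle_A$; (3) $\langle am,m'\rangle_A=\langle m,a^*m'\rangle_A$ and ${}_A\langle mb,m'\rangle={}_A\langle m,m'b^*\rangle$; (4) the norm of $M$ is equivalent to $\|{}_A\langle m,m\rangle\|^{1/2}$ and to $\|\langle m,m\rangle_A\|^{1/2}$; (5) ${}_A\langle m,n\rangle r=m\langle n,r\rangle_A$ for all $m,n,r\in M$. It is an imprimitivity bimodule if it is full, i.e. if the closed linear spans of $\{{}_A\langle m,n\rangle: m,n\in M\}$ and of $\{\langle m,n\rangle_A : m,n\in M\}$ are both equal to $A$. An isomorphism of such bimodules is a linear bijection that respects both actions and both inner products. Let $S(A)$ be the set of isomorphism classes $[M]$ of associative Hilbert $C^*$-bimodules over $A$, with multiplication $[M]\cdot[N]=[M\otimes_A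 N]$. Here $M\otimes_A N$ is the interior tensor product: the associative Hilbert $C^*$-bimodule, unique up to isomorphism, which carries an $A$-balanced bilinear map $(m,n)\mapsto m\otimes n$ from $M\times N$ with $a(m\otimes n)=am\otimes n$, $(m\otimes n)b=m\otimes nb$, ${}_A\langle m\otimes n,m'\otimes n'\rangle={}_A\langle m,m'\,{}_A\langle n,n'\rangle^*\rangle$ and $\langle m\otimes n,m'\otimes n'\rangle_A=\langle\langle m,m'\rangle_A^*\,n,n'\rangle_A$, and in which the elements $m\otimes n$ span a dense subspace. Let $\operatorname{Pic}(A)\subset S(A)$ be the set of classes of imprimitivity bimodules. **Proposition.** Let $A$ be simple, i.e. $A\neq 0$ and the only closed two-sided ideals of $A$ are $0$ and $A$. Then every nonzero associative Hilbert $C^*$-bimodule over $A$ is full, that is, an imprimitivity bimodule. Hence $S(A)=\{0\}\cup\operatorname{Pic}(A)$, that is, $S(A)$ is the Picard group of $A$ with a zero adjoined: the multiplication above makes $S(A)$ a monoid whose zero element is the class of the zero bimodule and whose unit is the class of $A$ (with ${}_A\langle x,y\rangle=xy^*$, $\langle x,y\rangle_A=x^*y$), it makes $\operatorname{Pic}(A)$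 a group, and the map from $\operatorname{Pic}(A)$ with a zero adjoined to $S(A)$ which is the inclusion on $\operatorname{Pic}(A)$ and sends the adjoined zero to $0$ is an isomorphism of semigroups. -/

import Mathlib

universe u u₁ u₂ u₃ v v₁ v₂ v₃

/-- A complex `C*`-algebra `A` (not necessarily unital) is *simple* if it is nonzero and its only
closed two-sided ideals are `0` and `A`. -/
structure IsSimpleCStarAlgebra (A : Type u) [NonUnitalCStarAlgebra A] : Prop where
  nontrivial : Nontrivial A
  eq_bot_or_eq_top : ∀ I : Submodule ℂ A, IsClosed (I : Set A) →
    (∀ a : A, ∀ x ∈ I, a * x ∈ I ∧ x * a ∈ I) → I = ⊥ ∨ I = ⊤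

/-- An associative Hilbert `C*`-bimodule, left over `A` and right over `B`: a Banach space `M` with
commuting nondegenerate actions of `A` (left, `lsmul a m` is `a m`) and `B` (right, `rsmul m b` is
`m b`), an `A`-valued inner product `innerL` (linear in the first variable) and a `B`-valued inner
product `innerR` (linear in the second variable). Completeness in the norms of the two inner
products follows from the equivalence of these norms with the norm of the Banach space. -/
structure HilbertBimodule (A : Type u₁) (B : Type u₂)
    [NonUnitalCStarAlgebra A] [PartialOrder A] [StarOrderedRing A]
    [NonUnitalCStarAlgebra B] [PartialOrder B] [StarOrderedRing B] where
  carrier : Type v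
  [normedAddCommGroup : NormedAddCommGroup carrier]
  [normedSpace : NormedSpace ℂ carrier]
  [completeSpace : CompleteSpace carrier]
  lsmul : A →ₗ[ℂ] carrier →ₗ[ℂ] carrier
  rsmul : carrier →ₗ[ℂ] B →ₗ[ℂ] carrier
  innerL : carrier →ₗ[ℂ] carrier →ₗ⋆[ℂ] A
  innerR : carrier →ₗ⋆[ℂ] carrier →ₗ[ℂ] B
  -- bimodule, with nondegenerate actions
  mul_lsmul : ∀ (a a' : A) (m : carrier), lsmul (a * a') m = lsmul a (lsmul a' m)
  rsmul_mul : ∀ (m : carrier) (b b' : B), rsmul m (b * b') = rsmul (rsmul m b) b'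
  lsmul_rsmul : ∀ (a : A) (m : carrier) (b : B), rsmul (lsmul a m) b = lsmul a (rsmul m b)
  lsmul_dense : Dense (Submodule.span ℂ {x : carrier | ∃ a m, x = lsmul a m} : Set carrier)
  rsmul_dense : Dense (Submodule.span ℂ {x : carrier | ∃ m b, x = rsmul m b} : Set carrier)
  -- left Hilbert module over `A`
  innerL_lsmul : ∀ (a : A) (m n : carrier), innerL (lsmul a m) n = a * innerL m n
  star_innerL : ∀ m n : carrier, star (innerL m n) = innerL n m
  innerL_self_nonneg : ∀ m : carrier, 0 ≤ innerL m m
  innerL_self_eq_zero : ∀ m : carrier, innerL m m = 0 → m = 0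
  -- right Hilbert module over `B`
  innerR_rsmul : ∀ (m n : carrier) (b : B), innerR m (rsmul n b) = innerR m n * b
  star_innerR : ∀ m n : carrier, star (innerR m n) = innerR n m
  innerR_self_nonneg : ∀ m : carrier, 0 ≤ innerR m m
  innerR_self_eq_zero : ∀ m : carrier, innerR m m = 0 → m = 0
  -- the actions are adjointable
  innerR_lsmul : ∀ (a : A) (m n : carrier), innerR (lsmul a m) n = innerR m (lsmul (star a) n)
  innerL_rsmul : ∀ (m n : carrier) (b : B), innerL (rsmul m b) n = innerL m (rsmul n (star b))
  -- the three norms are equivalent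
  normL_equiv : ∃ c C : ℝ, 0 < c ∧ 0 < C ∧
    ∀ m : carrier, c * ‖m‖ ≤ √‖innerL m m‖ ∧ √‖innerL m m‖ ≤ C * ‖m‖
  normR_equiv : ∃ c C : ℝ, 0 < c ∧ 0 < C ∧
    ∀ m : carrier, c * ‖m‖ ≤ √‖innerR m m‖ ∧ √‖innerR m m‖ ≤ C * ‖m‖
  -- associativity of the two inner products
  innerL_assoc : ∀ m n r : carrier, lsmul (innerL m n) r = rsmul m (innerR n r)

namespace HilbertBimodule

instance (A : Type u₁) (B : Type u₂)
    [NonUnitalCStarAlgebra A] [PartialOrder A] [StarOrderedRing A]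
    [NonUnitalCStarAlgebra B] [PartialOrder B] [StarOrderedRing B] :
    CoeSort (HilbertBimodule.{u₁, u₂, v} A B) (Type v) := ⟨carrier⟩

attribute [instance] normedAddCommGroup normedSpace completeSpace

section TwoAlgebras

variable {A : Type u₁} {B : Type u₂} {C : Type u₃}
  [NonUnitalCStarAlgebra A] [PartialOrder A] [StarOrderedRing A]
  [NonUnitalCStarAlgebra B] [PartialOrder B] [StarOrderedRing B]
  [NonUnitalCStarAlgebra C] [PartialOrder C] [StarOrderedRing C]

/-- The closed linear span of all `A`-valued inner products. -/
def leftIdeal (M : HilbertBimodule.{u₁, u₂, v} A B) : Submodule ℂ A :=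
  (Submodule.span ℂ {x : A | ∃ m n : M, x = M.innerL m n}).topologicalClosure

/-- The closed linear span of all `B`-valued inner products. -/
def rightIdeal (M : HilbertBimodule.{u₁, u₂, v} A B) : Submodule ℂ B :=
  (Submodule.span ℂ {x : B | ∃ m n : M, x = M.innerR m n}).topologicalClosure

/-- An imprimitivity bimodule is an associative Hilbert `C*`-bimodule that is full on both
sides. -/
def IsImprimitivity (M : HilbertBimodule.{u₁, u₂, v} A B) : Prop :=
  M.leftIdeal = ⊤ ∧ M.rightIdeal = ⊤

/-- Isomorphism of associative Hilbert `C*`-bimodules: a linear bijection that respects both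
actions and both inner products. -/
def Isomorphic (M : HilbertBimodule.{u₁, u₂, v₁} A B) (N : HilbertBimodule.{u₁, u₂, v₂} A B) :
    Prop :=
  ∃ e : M ≃ₗ[ℂ] N,
    (∀ a m, e (M.lsmul a m) = N.lsmul a (e m)) ∧
    (∀ m b, e (M.rsmul m b) = N.rsmul (e m) b) ∧
    (∀ m m', N.innerL (e m) (e m') = M.innerL m m') ∧
    (∀ m m', N.innerR (e m) (e m') = M.innerR m m')

theorem Isomorphic.refl (M : HilbertBimodule.{u₁, u₂, v} A B) : Isomorphic M M :=
  ⟨LinearEquiv.refl ℂ M, by simp⟩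

theorem Isomorphic.symm {M : HilbertBimodule.{u₁, u₂, v₁} A B}
    {N : HilbertBimodule.{u₁, u₂, v₂} A B} (h : Isomorphic M N) : Isomorphic N M := by
  obtain ⟨e, h1, h2, h3, h4⟩ := h
  refine ⟨e.symm, fun a m => ?_, fun m b => ?_, fun m m' => ?_, fun m m' => ?_⟩
  · apply e.injective; simp [h1]
  · apply e.injective; simp [h2]
  · simp [← h3]
  · simp [← h4]

theorem Isomorphic.trans {M : HilbertBimodule.{u₁, u₂, v₁} A B}
    {N : HilbertBimodule.{u₁, u₂, v₂} A B} {P : HilbertBimodule.{u₁, u₂, v₃} A B}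
    (h : Isomorphic M N) (h' : Isomorphic N P) : Isomorphic M P := by
  obtain ⟨e, h1, h2, h3, h4⟩ := h
  obtain ⟨f, k1, k2, k3, k4⟩ := h'
  exact ⟨e.trans f, by simp [h1, k1], by simp [h2, k2], by simp [h3, k3], by simp [h4, k4]⟩

/-- `P` is the interior tensor product `M ⊗_B N`: there is a `B`-balanced bilinear map
`t : M × N → P`, `(m, n) ↦ m ⊗ n`, compatible with the outer actions, with
`_A⟨m ⊗ n, m' ⊗ n'⟩ = _A⟨m, m' (_B⟨n, n'⟩)^*⟩` and
`⟨m ⊗ n, m' ⊗ n'⟩_C = ⟨⟨m, m'⟩_B^* n, n'⟩_C`, whose values span a dense subspace of `P`.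
These conditions determine `P` up to isomorphism. -/
def IsInteriorTensor (M : HilbertBimodule.{u₁, u₂, v₁} A B)
    (N : HilbertBimodule.{u₂, u₃, v₂} B C) (P : HilbertBimodule.{u₁, u₃, v₃} A C) : Prop :=
  ∃ t : M →ₗ[ℂ] N →ₗ[ℂ] P,
    (∀ m b n, t (M.rsmul m b) n = t m (N.lsmul b n)) ∧
    (∀ a m n, t (M.lsmul a m) n = P.lsmul a (t m n)) ∧
    (∀ m n c, t m (N.rsmul n c) = P.rsmul (t m n) c) ∧
    (∀ m n m' n', P.innerL (t m n) (t m' n') = M.innerL m (M.rsmul m' (star (N.innerL n n')))) ∧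
    (∀ m n m' n', P.innerR (t m n) (t m' n') = N.innerR (N.lsmul (star (M.innerR m m')) n) n') ∧
    Dense (Submodule.span ℂ {x : P | ∃ m n, x = t m n} : Set P)

end TwoAlgebras

section OneAlgebra

variable (A : Type u) [NonUnitalCStarAlgebra A] [PartialOrder A] [StarOrderedRing A]

/-- The zero bimodule over `A`. -/
noncomputable def zeroBimodule : HilbertBimodule.{u, u, u} A A where
  carrier := PUnit.{u + 1}
  lsmul := 0
  rsmul := 0
  innerL := 0
  innerR := 0
  mul_lsmul := by simp
  rsmul_mul := by simp
  lsmul_rsmul := by simp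
  lsmul_dense := by
    intro x
    rw [Subsingleton.elim x 0]
    exact subset_closure (Submodule.zero_mem _)
  rsmul_dense := by
    intro x
    rw [Subsingleton.elim x 0]
    exact subset_closure (Submodule.zero_mem _)
  innerL_lsmul := by simp
  star_innerL := by simp
  innerL_self_nonneg := by simp
  innerL_self_eq_zero := by simp
  innerR_rsmul := by simp
  star_innerR := by simp
  innerR_self_nonneg := by simp
  innerR_self_eq_zero := by simp
  innerR_lsmul := by simp
  innerL_rsmul := by simp
  normL_equiv := ⟨1, 1, one_pos, one_pos, by simp⟩
  normR_equiv := ⟨1, 1, one_pos, one_pos, by simp⟩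
  innerL_assoc := by simp

theorem exists_mul_near (x : A) (ε : ℝ) (hε : 0 < ε) :
    (∃ e : A, ‖x - e * x‖ < ε) ∧ ∃ e : A, ‖x - x * e‖ < ε := by
  have h := CStarAlgebra.increasingApproximateUnit A
  have := h.neBot
  constructor
  · have h1 := h.tendsto_mul_right x
    have h2 := (Metric.tendsto_nhds.mp h1 ε hε).exists
    obtain ⟨e, he⟩ := h2
    exact ⟨e, by rwa [dist_comm, dist_eq_norm] at he⟩
  · have h1 := h.tendsto_mul_left x
    have h2 := (Metric.tendsto_nhds.mp h1 ε hε).exists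
    obtain ⟨e, he⟩ := h2
    exact ⟨e, by rwa [dist_comm, dist_eq_norm] at he⟩

/-- `A` as a bimodule over itself, with `_A⟨x, y⟩ = x y^*` and `⟨x, y⟩_A = x^* y`. -/
noncomputable def unitBimodule : HilbertBimodule.{u, u, u} A A where
  carrier := A
  lsmul := LinearMap.mul ℂ A
  rsmul := LinearMap.mul ℂ A
  innerL := LinearMap.mk₂'ₛₗ (RingHom.id ℂ) (starRingEnd ℂ) (fun x y : A => x * star y)
    (by simp [add_mul]) (by intros; simp [smul_mul_assoc])
    (by simp [mul_add]) (by intros; simp [mul_smul_comm])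
  innerR := LinearMap.mk₂'ₛₗ (starRingEnd ℂ) (RingHom.id ℂ) (fun x y : A => star x * y)
    (by simp [add_mul]) (by intros; simp [smul_mul_assoc])
    (by simp [mul_add]) (by intros; simp [mul_smul_comm])
  mul_lsmul := by simp [mul_assoc]
  rsmul_mul := by simp [mul_assoc]
  lsmul_rsmul := by simp [mul_assoc]
  lsmul_dense := by
    intro x
    refine Metric.mem_closure_iff.mpr fun ε hε => ?_
    obtain ⟨⟨e, he⟩, -⟩ := exists_mul_near A x ε hε
    exact ⟨e * x, Submodule.subset_span ⟨e, x, rfl⟩, by rwa [dist_eq_norm]⟩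
  rsmul_dense := by
    intro x
    refine Metric.mem_closure_iff.mpr fun ε hε => ?_
    obtain ⟨-, e, he⟩ := exists_mul_near A x ε hε
    exact ⟨x * e, Submodule.subset_span ⟨x, e, rfl⟩, by rwa [dist_eq_norm]⟩
  innerL_lsmul := by simp [mul_assoc]
  star_innerL := by simp
  innerL_self_nonneg := by simp [mul_star_self_nonneg]
  innerL_self_eq_zero := by simp [CStarRing.mul_star_self_eq_zero_iff]
  innerR_rsmul := by simp [mul_assoc]
  star_innerR := by simp
  innerR_self_nonneg := by simp [star_mul_self_nonneg]
  innerR_self_eq_zero := by simp [CStarRing.star_mul_self_eq_zero_iff]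
  innerR_lsmul := by simp [mul_assoc]
  innerL_rsmul := by simp [mul_assoc]
  normL_equiv := ⟨1, 1, one_pos, one_pos, by simp [CStarRing.norm_self_mul_star]⟩
  normR_equiv := ⟨1, 1, one_pos, one_pos, by simp [CStarRing.norm_star_mul_self]⟩
  innerL_assoc := by simp [mul_assoc]

instance isomorphicSetoid : Setoid (HilbertBimodule.{u, u, u} A A) where
  r M N := Isomorphic M N
  iseqv := ⟨Isomorphic.refl, Isomorphic.symm, Isomorphic.trans⟩

/-- `S(A)`: the isomorphism classes of associative Hilbert `C*`-bimodules over `A`. -/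
def IsoClass : Type (u + 1) := Quotient (isomorphicSetoid A)

variable {A}

/-- The isomorphism class of a bimodule. -/
def isoClass (M : HilbertBimodule.{u, u, u} A A) : IsoClass A := Quotient.mk _ M

variable (A)

/-- The underlying set of the Picard group of `A`: the isomorphism classes of imprimitivity
bimodules over `A`. -/
def Pic : Type (u + 1) :=
  {x : IsoClass A // ∃ M : HilbertBimodule.{u, u, u} A A, M.IsImprimitivity ∧ isoClass M = x}

end OneAlgebra

end HilbertBimodule

/-! For simple `A`, fullness is immediate: the closed span of the left inner products is a closed
two-sided ideal, and it contains `⟨m, m⟩ ≠ 0` as soon as `m ≠ 0`. The right-hand statement is the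
same one for the conjugate bimodule. The inverse of a full `M` is its conjugate: `m ⊗ n ↦ _A⟨m, n⟩`
identifies `M ⊗ M.dual` with `A`, where compatibility of the inner products is the associativity law
and density of the range is fullness. So `Pic(A)` is the set of nonzero classes, all of them
invertible, and zero divisors are excluded.

Most of the work is to show that interior tensor products exist and form a monoid. The tensor
product over `ℂ` carries two sesquilinear forms, whose positivity is the main point
(`sum_innerR_lsmul_innerR_nonneg`): finitely many `m i` are nearly fixed by some `p = ∑ ⟨x, x⟩`, and
inserting `p` turns the form into a sum of squares. Completion then requires that the operations be
bounded for a single seminorm. Both inner products define the same one (`norm_innerL_self`), because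
`⟨x, x⟩x = x⟨x, x⟩` up to null vectors. Completing also divides out null vectors, which makes the
tensor product balanced over the middle algebra.

Uniqueness and associativity follow from one criterion (`isomorphic_of_denseRange`): a bimodule is
determined by its two inner products on a dense subspace. Conjugation exchanges left and right
throughout, so most estimates are proved on one side only. -/

/-! ### Conjugate spaces and pre-Hilbert bimodules -/

/-- The conjugate of a complex vector space: the same additive group, on which a scalar `c` acts as
the conjugate of `c` does on the original space. -/
def ConjSpace (E : Type v) : Type v := E

namespace ConjSpace

variable {E : Type v}

instance [AddCommGroup E] : AddCommGroup (ConjSpace E) := inferInstanceAs (AddCommGroup E)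

instance [AddCommGroup E] [Module ℂ E] : Module ℂ (ConjSpace E) :=
  Module.compHom E (starRingEnd ℂ)

/-- The identity map from a space to its conjugate. -/
def of [AddCommGroup E] [Module ℂ E] : E ≃ₗ⋆[ℂ] ConjSpace E where
  __ := AddEquiv.refl E
  map_smul' c x := by
    change c • x = (starRingEnd ℂ) ((starRingEnd ℂ) c) • x
    rw [Complex.conj_conj]

@[simp]
theorem of_smul [AddCommGroup E] [Module ℂ E] (c : ℂ) (x : E) :
    of ((starRingEnd ℂ) c • x) = c • of x := by
  rw [of.map_smulₛₗ, starRingEnd_self_apply]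

@[simp]
theorem of_symm_smul [AddCommGroup E] [Module ℂ E] (c : ℂ) (x : ConjSpace E) :
    of.symm (c • x) = (starRingEnd ℂ) c • of.symm x :=
  of.symm.map_smulₛₗ c x

end ConjSpace

/-- The algebraic part of an associative Hilbert bimodule: the inner products are only required to
be positive semidefinite, and the associativity law holds up to null vectors. -/
structure PreHilbertBimodule (A : Type u₁) (B : Type u₂)
    [NonUnitalCStarAlgebra A] [PartialOrder A] [StarOrderedRing A]
    [NonUnitalCStarAlgebra B] [PartialOrder B] [StarOrderedRing B] where
  carrier : Type v
  [addCommGroup : AddCommGroup carrier]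
  [module : Module ℂ carrier]
  lsmul : A →ₗ[ℂ] carrier →ₗ[ℂ] carrier
  rsmul : carrier →ₗ[ℂ] B →ₗ[ℂ] carrier
  innerL : carrier →ₗ[ℂ] carrier →ₗ⋆[ℂ] A
  innerR : carrier →ₗ⋆[ℂ] carrier →ₗ[ℂ] B
  mul_lsmul : ∀ (a a' : A) (m : carrier), lsmul (a * a') m = lsmul a (lsmul a' m)
  rsmul_mul : ∀ (m : carrier) (b b' : B), rsmul m (b * b') = rsmul (rsmul m b) b'
  lsmul_rsmul : ∀ (a : A) (m : carrier) (b : B), rsmul (lsmul a m) b = lsmul a (rsmul m b)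
  innerL_lsmul : ∀ (a : A) (m n : carrier), innerL (lsmul a m) n = a * innerL m n
  star_innerL : ∀ m n : carrier, star (innerL m n) = innerL n m
  innerL_self_nonneg : ∀ m : carrier, 0 ≤ innerL m m
  innerR_rsmul : ∀ (m n : carrier) (b : B), innerR m (rsmul n b) = innerR m n * b
  star_innerR : ∀ m n : carrier, star (innerR m n) = innerR n m
  innerR_self_nonneg : ∀ m : carrier, 0 ≤ innerR m m
  innerR_lsmul : ∀ (a : A) (m n : carrier), innerR (lsmul a m) n = innerR m (lsmul (star a) n)
  innerL_rsmul : ∀ (m n : carrier) (b : B), innerL (rsmul m b) n = innerL m (rsmul n (star b))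
  innerR_assoc : ∀ z m n r : carrier,
    innerR z (lsmul (innerL m n) r) = innerR z (rsmul m (innerR n r))
  innerL_assoc : ∀ z m n r : carrier,
    innerL z (lsmul (innerL m n) r) = innerL z (rsmul m (innerR n r))

namespace PreHilbertBimodule

attribute [instance] addCommGroup module

variable {A : Type u₁} {B : Type u₂}
  [NonUnitalCStarAlgebra A] [PartialOrder A] [StarOrderedRing A]
  [NonUnitalCStarAlgebra B] [PartialOrder B] [StarOrderedRing B]

/-- The conjugate bimodule, on which the two algebras and the two inner products trade places. -/
def dual (E : PreHilbertBimodule.{u₁, u₂, v} A B) : PreHilbertBimodule.{u₂, u₁, v} B A where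
  carrier := ConjSpace E.carrier
  lsmul := LinearMap.mk₂ ℂ
    (fun (b : B) (m : ConjSpace E.carrier) => ConjSpace.of (E.rsmul (ConjSpace.of.symm m) (star b)))
    (by simp) (by simp) (by simp) (by simp)
  rsmul := LinearMap.mk₂ ℂ
    (fun (m : ConjSpace E.carrier) (a : A) => ConjSpace.of (E.lsmul (star a) (ConjSpace.of.symm m)))
    (by simp) (by simp) (by simp) (by simp)
  innerL := LinearMap.mk₂'ₛₗ (RingHom.id ℂ) (starRingEnd ℂ)
    (fun m n : ConjSpace E.carrier => E.innerR (ConjSpace.of.symm m) (ConjSpace.of.symm n))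
    (by simp) (by simp) (by simp) (by simp)
  innerR := LinearMap.mk₂'ₛₗ (starRingEnd ℂ) (RingHom.id ℂ)
    (fun m n : ConjSpace E.carrier => E.innerL (ConjSpace.of.symm m) (ConjSpace.of.symm n))
    (by simp) (by simp) (by simp) (by simp)
  mul_lsmul := by simp [E.rsmul_mul]
  rsmul_mul := by simp [E.mul_lsmul]
  lsmul_rsmul := by simp [E.lsmul_rsmul]
  innerL_lsmul b m n := by
    simp only [LinearMap.mk₂_apply, LinearMap.mk₂'ₛₗ_apply, LinearEquiv.symm_apply_apply]
    rw [← E.star_innerR, E.innerR_rsmul, star_mul, E.star_innerR, star_star]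
  star_innerL := by simp [E.star_innerR]
  innerL_self_nonneg := by simp [E.innerR_self_nonneg]
  innerR_rsmul m n a := by
    simp only [LinearMap.mk₂_apply, LinearMap.mk₂'ₛₗ_apply, LinearEquiv.symm_apply_apply]
    rw [← E.star_innerL, E.innerL_lsmul, star_mul, E.star_innerL, star_star]
  star_innerR := by simp [E.star_innerL]
  innerR_self_nonneg := by simp [E.innerL_self_nonneg]
  innerR_lsmul := by simp [E.innerL_rsmul]
  innerL_rsmul := by simp [E.innerR_lsmul]
  innerR_assoc z m n r := by simp [E.innerL_assoc, E.star_innerL, E.star_innerR]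
  innerL_assoc z m n r := by simp [E.innerR_assoc, E.star_innerL, E.star_innerR]

/-! ### Cauchy–Schwarz and the seminorm of the right inner product -/

variable (E : PreHilbertBimodule.{u₁, u₂, v} A B)

theorem innerR_rsmul_left (m n : E.carrier) (b : B) :
    E.innerR (E.rsmul m b) n = star b * E.innerR m n := by
  rw [← E.star_innerR, E.innerR_rsmul, star_mul, E.star_innerR]

theorem norm_innerR_comm (x y : E.carrier) : ‖E.innerR x y‖ = ‖E.innerR y x‖ := by
  rw [← E.star_innerR, norm_star]

/-- With `b = ⟨y, x⟩`, positivity of `⟨x - s y b, x - s y b⟩` and the bound `b* ⟨y, y⟩ b ≤ ‖⟨y, y⟩‖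
b* b` give `(2s - s² ‖⟨y, y⟩‖) b* b ≤ ⟨x, x⟩` for real `s ≥ 0`. The optimal choice is `s = ‖⟨y,
y⟩‖⁻¹`. -/
theorem norm_innerR_sq_le (x y : E.carrier) :
    ‖E.innerR x y‖ ^ 2 ≤ ‖E.innerR x x‖ * ‖E.innerR y y‖ := by
  set b := E.innerR y x with hb
  have hbs : star b = E.innerR x y := E.star_innerR y x
  have hnb : ‖star b * b‖ = ‖E.innerR x y‖ ^ 2 := by
    rw [CStarRing.norm_star_mul_self, hb, E.norm_innerR_comm, sq]
  have key : ∀ s : ℝ, 0 ≤ s → (2 * s - s ^ 2 * ‖E.innerR y y‖) * ‖E.innerR x y‖ ^ 2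
      ≤ ‖E.innerR x x‖ := by
    intro s hs
    rcases le_total (2 * s - s ^ 2 * ‖E.innerR y y‖) 0 with h0 | h0
    · exact (mul_nonpos_of_nonpos_of_nonneg h0 (sq_nonneg _)).trans (norm_nonneg _)
    have h1 := E.innerR_self_nonneg (x - (s : ℂ) • E.rsmul y b)
    have h2 : E.innerR (x - (s : ℂ) • E.rsmul y b) (x - (s : ℂ) • E.rsmul y b)
        = E.innerR x x - (2 * s) • (star b * b) + s ^ 2 • (star b * E.innerR y y * b) := by
      have e1 : E.innerR x (E.rsmul y b) = star b * b := by rw [E.innerR_rsmul, hbs]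
      have e2 : E.innerR (E.rsmul y b) x = star b * b := by rw [E.innerR_rsmul_left]
      have e3 : E.innerR (E.rsmul y b) (E.rsmul y b) = star b * E.innerR y y * b := by
        rw [E.innerR_rsmul, E.innerR_rsmul_left]
      rw [LinearMap.map_sub₂, map_sub, map_sub, LinearMap.map_smulₛₗ₂, LinearMap.map_smulₛₗ₂,
        map_smul, map_smul, e1, e2, e3, Complex.conj_ofReal]
      simp only [← Complex.coe_smul]
      push_cast
      module
    have h3 : star b * E.innerR y y * b ≤ ‖E.innerR y y‖ • (star b * b) :=
      CStarAlgebra.star_left_conjugate_le_norm_smul (hb := E.star_innerR y y)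
    have h4 : (2 * s - s ^ 2 * ‖E.innerR y y‖) • (star b * b) ≤ E.innerR x x := by
      rw [h2] at h1
      have h5 := smul_le_smul_of_nonneg_left h3 (sq_nonneg s)
      rw [← sub_nonneg] at h5 ⊢
      have := add_nonneg h1 h5
      convert this using 1
      module
    have h6 := CStarAlgebra.norm_le_norm_of_nonneg_of_le
      (smul_nonneg h0 (star_mul_self_nonneg b)) h4
    rwa [norm_smul, hnb, Real.norm_of_nonneg h0] at h6
  rcases (norm_nonneg (E.innerR y y)).eq_or_lt with h | h
  · rw [← h, mul_zero]
    by_contra! hc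
    -- When `⟨y, y⟩ = 0` the bound is linear in `s`; this value yields `2 (‖⟨x, x⟩‖ + 1) ≤ ‖⟨x,
    -- x⟩‖`.
    have := key ((‖E.innerR x x‖ + 1) / ‖E.innerR x y‖ ^ 2) (by positivity)
    rw [← h, mul_zero, sub_zero, mul_assoc, div_mul_cancel₀ _ hc.ne'] at this
    linarith [norm_nonneg (E.innerR x x)]
  · have := key (‖E.innerR y y‖⁻¹) (by positivity)
    have h7 : 2 * ‖E.innerR y y‖⁻¹ - ‖E.innerR y y‖⁻¹ ^ 2 * ‖E.innerR y y‖
        = ‖E.innerR y y‖⁻¹ := by field_simp; ring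
    rw [h7, inv_mul_le_iff₀ h] at this
    linarith

/-- The seminorm of the right inner product. -/
noncomputable def normR (x : E.carrier) : ℝ := √‖E.innerR x x‖

theorem normR_nonneg (x : E.carrier) : 0 ≤ E.normR x := Real.sqrt_nonneg _

theorem normR_sq (x : E.carrier) : E.normR x ^ 2 = ‖E.innerR x x‖ := Real.sq_sqrt (norm_nonneg _)

theorem norm_innerR_le (x y : E.carrier) : ‖E.innerR x y‖ ≤ E.normR x * E.normR y := by
  refine abs_le_of_sq_le_sq' ?_ (mul_nonneg (E.normR_nonneg x) (E.normR_nonneg y)) |>.2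
  rw [mul_pow, E.normR_sq, E.normR_sq]
  exact E.norm_innerR_sq_le x y

theorem normR_add_le (x y : E.carrier) : E.normR (x + y) ≤ E.normR x + E.normR y := by
  refine abs_le_of_sq_le_sq' ?_ (add_nonneg (E.normR_nonneg x) (E.normR_nonneg y)) |>.2
  rw [E.normR_sq, LinearMap.map_add₂, map_add, map_add]
  have h1 := E.norm_innerR_le x y
  have h2 := E.norm_innerR_le y x
  have h3 := E.normR_sq x
  have h4 := E.normR_sq y
  have h5 := norm_add_le (E.innerR x x + E.innerR x y) (E.innerR y x + E.innerR y y)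
  have h6 := norm_add_le (E.innerR x x) (E.innerR x y)
  have h7 := norm_add_le (E.innerR y x) (E.innerR y y)
  linarith

theorem normR_smul (c : ℂ) (x : E.carrier) : E.normR (c • x) = ‖c‖ * E.normR x := by
  rw [normR, LinearMap.map_smulₛₗ₂, map_smul, smul_smul, norm_smul, norm_mul,
    RCLike.norm_conj, Real.sqrt_mul (by positivity), Real.sqrt_mul_self (norm_nonneg _), normR]

theorem normR_rsmul_le (x : E.carrier) (b : B) : E.normR (E.rsmul x b) ≤ ‖b‖ * E.normR x := by
  refine abs_le_of_sq_le_sq' ?_ (mul_nonneg (norm_nonneg b) (E.normR_nonneg x)) |>.2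
  rw [E.normR_sq, E.innerR_rsmul, E.innerR_rsmul_left, mul_pow, E.normR_sq]
  calc ‖star b * E.innerR x x * b‖ ≤ ‖star b * E.innerR x x‖ * ‖b‖ := norm_mul_le _ _
    _ ≤ ‖star b‖ * ‖E.innerR x x‖ * ‖b‖ := by gcongr; exact norm_mul_le _ _
    _ = ‖b‖ ^ 2 * ‖E.innerR x x‖ := by rw [norm_star]; ring

end PreHilbertBimodule

/-! ### Boundedness of the left action and equality of the two seminorms -/

/-- In a possibly nonunital `C*`-algebra, `‖a‖² - a* a` has a square root `‖a‖ + x` in the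
unitization. -/
theorem exists_sq_norm_add_eq {A : Type u} [NonUnitalCStarAlgebra A] [PartialOrder A]
    [StarOrderedRing A] (a : A) :
    ∃ x : A, star x = x ∧ (2 * ‖a‖) • x + x * x = -(star a * a) := by
  have h0 : 0 ≤ star a * a := star_mul_self_nonneg a
  have hsa : IsSelfAdjoint (star a * a) := IsSelfAdjoint.star_mul_self a
  -- Since `f 0 = 0`, the nonunital functional calculus applies. For `t ≤ ‖a‖²`, hence on the
  -- quasispectrum of `a* a`, one has `(‖a‖ + f t)² = ‖a‖² - t`.
  let f : ℝ → ℝ := fun t => √(‖a‖ ^ 2 - t) - ‖a‖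
  have hf : Continuous f := by fun_prop
  have hf0 : f 0 = 0 := by simp [f]
  refine ⟨cfcₙ f (star a * a), (cfcₙ_predicate f (star a * a)).star_eq, ?_⟩
  rw [← cfcₙ_const_mul _ _ _ (by fun_prop) hf0,
    ← cfcₙ_mul _ _ _ (by fun_prop) hf0 (by fun_prop) hf0,
    ← cfcₙ_add _ _ _ (by fun_prop) (by simp [hf0]) (by fun_prop) (by simp [hf0])]
  conv_rhs => rw [← cfcₙ_id' ℝ (star a * a) hsa]
  rw [← cfcₙ_neg]
  refine cfcₙ_congr fun t ht => ?_
  have ht1 : ‖t‖ ≤ ‖star a * a‖ := by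
    exact NonUnitalIsometricContinuousFunctionalCalculus.norm_quasispectrum_le _ ht hsa
  have ht2 : t ≤ ‖a‖ ^ 2 := by
    rw [CStarRing.norm_star_mul_self] at ht1
    nlinarith [le_abs_self t, Real.norm_eq_abs t]
  have := Real.mul_self_sqrt (sub_nonneg.mpr ht2)
  simp only [f]
  nlinarith

namespace PreHilbertBimodule

variable {A : Type u₁} {B : Type u₂}
  [NonUnitalCStarAlgebra A] [PartialOrder A] [StarOrderedRing A]
  [NonUnitalCStarAlgebra B] [PartialOrder B] [StarOrderedRing B]
  (E : PreHilbertBimodule.{u₁, u₂, v} A B)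

/-- With `y` as in `exists_sq_norm_add_eq`, the vector `‖a‖ x + y x` has inner square `‖a‖² ⟨x, x⟩ -
⟨a x, a x⟩`, so this difference is positive. The argument needs neither completeness nor
definiteness. -/
theorem normR_lsmul_le (a : A) (x : E.carrier) : E.normR (E.lsmul a x) ≤ ‖a‖ * E.normR x := by
  refine abs_le_of_sq_le_sq' ?_ (mul_nonneg (norm_nonneg a) (E.normR_nonneg x)) |>.2
  rw [E.normR_sq, mul_pow, E.normR_sq]
  obtain ⟨y, hy, h⟩ := exists_sq_norm_add_eq a
  have h1 := E.innerR_self_nonneg ((‖a‖ : ℂ) • x + E.lsmul y x)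
  have h2 : E.innerR ((‖a‖ : ℂ) • x + E.lsmul y x) ((‖a‖ : ℂ) • x + E.lsmul y x)
      = ‖a‖ ^ 2 • E.innerR x x + E.innerR x (E.lsmul ((2 * ‖a‖) • y + y * y) x) := by
    have hc : (2 * ‖a‖) • y = ((2 * ‖a‖ : ℝ) : ℂ) • y := (Complex.coe_smul _ _).symm
    simp only [hc, map_add, LinearMap.add_apply, LinearMap.map_smulₛₗ, LinearMap.smul_apply,
      E.innerR_lsmul, hy, RingHom.id_apply, Complex.conj_ofReal, E.mul_lsmul]
    simp only [Complex.coe_smul]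
    module
  have h3 : E.innerR (E.lsmul a x) (E.lsmul a x) ≤ ‖a‖ ^ 2 • E.innerR x x := by
    rw [h2, h, map_neg, LinearMap.neg_apply, map_neg, E.mul_lsmul, ← E.innerR_lsmul] at h1
    rw [← sub_nonneg, sub_eq_add_neg]
    exact h1
  have := CStarAlgebra.norm_le_norm_of_nonneg_of_le (E.innerR_self_nonneg _) h3
  rwa [norm_smul, Real.norm_of_nonneg (sq_nonneg _)] at this

/-- Up to null vectors `a x = x R`, so `⟨a x, a x⟩ = R³`, whose norm is `‖R‖³` and is at most `‖a‖²
‖R‖` by boundedness of the left action. The reverse inequality is this one for the conjugate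
bimodule. -/
theorem norm_innerR_self_le (x : E.carrier) : ‖E.innerR x x‖ ≤ ‖E.innerL x x‖ := by
  set R := E.innerR x x with hR
  set a := E.innerL x x with ha
  rcases eq_or_ne R 0 with h0 | h0
  · rw [h0, norm_zero]; exact norm_nonneg _
  have h1 : E.innerR (E.lsmul a x) (E.lsmul a x) = R * R * R := by
    rw [ha, E.innerR_assoc, ← E.star_innerR, E.innerR_assoc, E.star_innerR, E.innerR_rsmul,
      E.innerR_rsmul_left, ← hR, hR, E.star_innerR]
  have hs : star R = R := E.star_innerR x x
  -- Two uses of the `C*`-identity give `‖R⁴‖ = ‖R‖⁴`; one factor `‖R‖` is then cancelled.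
  have h2 : ‖R‖ ^ 3 ≤ ‖R * R * R‖ := by
    have h3 : ‖R * R * R * R‖ = ‖R‖ ^ 4 := by
      rw [mul_assoc (R * R)]
      have : ‖star (R * R) * (R * R)‖ = ‖R * R‖ * ‖R * R‖ := CStarRing.norm_star_mul_self
      rw [star_mul, hs] at this
      have h5 : ‖star R * R‖ = ‖R‖ * ‖R‖ := CStarRing.norm_star_mul_self
      rw [hs] at h5
      rw [this, h5]; ring
    have h4 := norm_mul_le (R * R * R) R
    have : 0 < ‖R‖ := norm_pos_iff.mpr h0
    rw [h3] at h4
    nlinarith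
  have h3 := E.normR_lsmul_le a x
  have h4 : ‖R * R * R‖ ≤ ‖a‖ ^ 2 * ‖R‖ := by
    rw [← h1, ← E.normR_sq, hR, ← E.normR_sq, ← mul_pow]
    exact pow_le_pow_left₀ (E.normR_nonneg _) h3 2
  have h5 : 0 < ‖R‖ := norm_pos_iff.mpr h0
  have h6 : ‖R‖ ^ 2 ≤ ‖a‖ ^ 2 := by
    have := h2.trans h4
    rw [pow_succ] at this
    exact le_of_mul_le_mul_right this h5
  exact abs_le_of_sq_le_sq' h6 (norm_nonneg _) |>.2

theorem norm_innerL_self (x : E.carrier) : ‖E.innerL x x‖ = ‖E.innerR x x‖ :=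
  le_antisymm (E.dual.norm_innerR_self_le x) (E.norm_innerR_self_le x)

theorem norm_innerL_le (x y : E.carrier) : ‖E.innerL x y‖ ≤ E.normR x * E.normR y := by
  have h : ∀ z : E.carrier, E.dual.normR z = E.normR z := fun z =>
    congrArg Real.sqrt (E.norm_innerL_self z)
  rw [← h x, ← h y]
  exact E.dual.norm_innerR_le x y

end PreHilbertBimodule

/-! ### Completion of a pre-Hilbert bimodule -/

/-- A bounded sesquilinear map extends along dense linear maps into normed spaces. -/
theorem LinearMap.exists_extend₂ {E₁ E₂ K₁ K₂ F : Type*} [AddCommGroup E₁] [Module ℂ E₁]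
    [AddCommGroup E₂] [Module ℂ E₂] [NormedAddCommGroup K₁] [NormedSpace ℂ K₁]
    [NormedAddCommGroup K₂] [NormedSpace ℂ K₂] [NormedAddCommGroup F] [NormedSpace ℂ F]
    [CompleteSpace F] {σ τ : ℂ →+* ℂ} [RingHomIsometric σ] [RingHomIsometric τ]
    (f : E₁ →ₛₗ[σ] E₂ →ₛₗ[τ] F) {i : E₁ →ₗ[ℂ] K₁} {j : E₂ →ₗ[ℂ] K₂}
    (hi : DenseRange i) (hj : DenseRange j) {C : ℝ} (hC : 0 ≤ C)
    (hf : ∀ x y, ‖f x y‖ ≤ C * ‖i x‖ * ‖j y‖) :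
    ∃ g : K₁ →ₛₗ[σ] K₂ →ₛₗ[τ] F,
      (∀ {X : Type v} [TopologicalSpace X] {p : X → K₁} {q : X → K₂}, Continuous p → Continuous q →
        Continuous fun x => g (p x) (q x)) ∧
      ∀ x y, g (i x) (j y) = f x y := by
  have h1 : ∀ x y, (f x).extendOfNorm j (j y) = f x y := fun x y =>
    LinearMap.extendOfNorm_eq hj ⟨_, hf x⟩ y
  -- The extension is made in the second variable first; the resulting map into bounded operators is
  -- then extended in the first.
  let G : E₁ →ₛₗ[σ] K₂ →SL[τ] F :=
    { toFun := fun x => (f x).extendOfNorm j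
      map_add' := fun x x' => by
        refine ContinuousLinearMap.ext fun z => hj.induction_on z
          (isClosed_eq (by fun_prop) (by fun_prop)) fun y => ?_
        rw [_root_.add_apply, h1, h1, h1, map_add, LinearMap.add_apply]
      map_smul' := fun c x => by
        refine ContinuousLinearMap.ext fun z => hj.induction_on z
          (isClosed_eq (by fun_prop) (by fun_prop)) fun y => ?_
        rw [_root_.smul_apply, h1, h1, f.map_smulₛₗ, LinearMap.smul_apply] }
  have hG : ∀ x, ‖G x‖ ≤ C * ‖i x‖ := fun x =>
    LinearMap.opNorm_extendOfNorm_le hj (by positivity) (hf x)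
  let H := G.extendOfNorm i
  refine ⟨H.toLinearMap₁₂, fun {X} _ {p q} hp hq => ?_, fun x y => ?_⟩
  · refine continuous_iff_continuousAt.mpr fun x₀ => tendsto_iff_norm_sub_tendsto_zero.mpr ?_
    have hc : Continuous fun x =>
        ‖H (p x) - H (p x₀)‖ * ‖q x‖ + ‖H (p x₀) (q x) - H (p x₀) (q x₀)‖ := by fun_prop
    refine squeeze_zero (fun x => norm_nonneg _) (fun x => ?_)
      ((hc.tendsto x₀).trans_eq (by simp))
    refine le_trans (le_of_eq_of_le ?_ (norm_add_le _ _))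
      (add_le_add_left ((H (p x) - H (p x₀)).le_opNorm (q x)) _)
    simp
  · have : H (i x) = G x := LinearMap.extendOfNorm_eq hi ⟨_, hG⟩ x
    change H (i x) (j y) = _
    rw [this]
    exact h1 x y

namespace PreHilbertBimodule

variable {A : Type u₁} {B : Type u₂}
  [NonUnitalCStarAlgebra A] [PartialOrder A] [StarOrderedRing A]
  [NonUnitalCStarAlgebra B] [PartialOrder B] [StarOrderedRing B]
  (E : PreHilbertBimodule.{u₁, u₂, v} A B)

/-- The completion is Hausdorff, so it also divides out the null vectors. -/
theorem exists_banach_completion :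
    ∃ (K : Type v) (_ : NormedAddCommGroup K) (_ : NormedSpace ℂ K) (_ : CompleteSpace K)
      (i : E.carrier →ₗ[ℂ] K), DenseRange i ∧ ∀ x, ‖i x‖ = E.normR x := by
  let : Norm E.carrier := ⟨E.normR⟩
  have core : SeminormedSpace.Core ℂ E.carrier := ⟨E.normR_nonneg, E.normR_smul, E.normR_add_le⟩
  let := SeminormedAddCommGroup.ofCore core
  let : NormedSpace ℂ E.carrier := ⟨fun c x => (E.normR_smul c x).le⟩
  refine ⟨UniformSpace.Completion E.carrier, inferInstance, inferInstance, inferInstance,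
    (UniformSpace.Completion.toComplL (𝕜 := ℂ) (E := E.carrier)).toLinearMap, ?_, ?_⟩
  · exact UniformSpace.Completion.denseRange_coe
  · exact fun x => UniformSpace.Completion.norm_coe x

/-- For `d = ⟨x, x⟩ - ⟨x, x⟩ b` one has `⟨x - x b, x - x b⟩ = d - b* d`. Its norm is at most `2 ‖d‖`
when `‖b‖ ≤ 1`, and `d` tends to zero along an approximate unit. -/
theorem exists_rsmul_near (x : E.carrier) {ε : ℝ} (hε : 0 < ε) :
    ∃ b : B, E.normR (x - E.rsmul x b) < ε := by
  have h := CStarAlgebra.increasingApproximateUnit B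
  have := h.neBot
  have h1 := h.tendsto_mul_left (E.innerR x x)
  have h2 := Metric.tendsto_nhds.mp h1 (ε ^ 2 / 2) (by positivity)
  obtain ⟨b, hb, hb1⟩ := (h2.and h.eventually_norm).exists
  refine ⟨b, abs_lt_of_sq_lt_sq' ?_ hε.le |>.2⟩
  rw [E.normR_sq, LinearMap.map_sub₂, map_sub, map_sub, E.innerR_rsmul_left, E.innerR_rsmul_left,
    E.innerR_rsmul, ← mul_sub]
  rw [dist_comm, dist_eq_norm] at hb
  set d := E.innerR x x - E.innerR x x * b
  calc ‖d - star b * d‖ ≤ ‖d‖ + ‖star b * d‖ := norm_sub_le _ _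
    _ ≤ ‖d‖ + ‖star b‖ * ‖d‖ := by gcongr; exact norm_mul_le _ _
    _ ≤ ‖d‖ + 1 * ‖d‖ := by gcongr; rwa [norm_star]
    _ < ε ^ 2 := by linarith

theorem dual_normR (x : E.carrier) : E.dual.normR (ConjSpace.of x) = E.normR x :=
  congrArg Real.sqrt (E.norm_innerL_self x)

theorem exists_lsmul_near (x : E.carrier) {ε : ℝ} (hε : 0 < ε) :
    ∃ a : A, E.normR (x - E.lsmul a x) < ε := by
  obtain ⟨a, ha⟩ := E.dual.exists_rsmul_near (ConjSpace.of x) hε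
  refine ⟨star a, ?_⟩
  rw [← E.dual_normR]
  exact ha

/-- The actions and inner products are bounded for the seminorm, so they extend continuously. Each
algebraic law, and positivity, is a closed condition and can be checked on the dense image.
Nondegeneracy comes from approximate units. -/
theorem exists_completion : ∃ (P : HilbertBimodule.{u₁, u₂, v} A B) (i : E.carrier →ₗ[ℂ] P),
    DenseRange i ∧ (∀ a x, i (E.lsmul a x) = P.lsmul a (i x)) ∧
    (∀ x b, i (E.rsmul x b) = P.rsmul (i x) b) ∧
    (∀ x y, P.innerL (i x) (i y) = E.innerL x y) ∧
    (∀ x y, P.innerR (i x) (i y) = E.innerR x y) := by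
  obtain ⟨K, _, _, _, i, hi, hn⟩ := E.exists_banach_completion
  obtain ⟨l, cl, hl⟩ := LinearMap.exists_extend₂.{v} (E.lsmul.compr₂ i) (i := LinearMap.id) (j := i)
    Function.surjective_id.denseRange hi zero_le_one (fun a x => by
      simpa [hn] using E.normR_lsmul_le a x)
  obtain ⟨r, cr, hr⟩ := LinearMap.exists_extend₂.{v} (E.rsmul.compr₂ i) (i := i) (j := LinearMap.id)
    hi Function.surjective_id.denseRange zero_le_one (fun x b => by
      simpa [hn, mul_comm] using E.normR_rsmul_le x b)
  obtain ⟨L, cL, hL⟩ := LinearMap.exists_extend₂.{v} E.innerL hi hi zero_le_one (fun x y => by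
      simpa [hn] using E.norm_innerL_le x y)
  obtain ⟨R, cR, hR⟩ := LinearMap.exists_extend₂.{v} E.innerR hi hi zero_le_one (fun x y => by
      simpa [hn] using E.norm_innerR_le x y)
  replace hl : ∀ a x, l a (i x) = i (E.lsmul a x) := hl
  replace hr : ∀ x b, r (i x) b = i (E.rsmul x b) := hr
  have c1 := continuous_id (X := K)
  have d1 := continuous_fst (X := K) (Y := K)
  have d2 := continuous_snd (X := K) (Y := K)
  have t1 := continuous_fst (X := K) (Y := K × K)
  have t2 := (continuous_snd (X := K) (Y := K × K)).fst
  have t3 := (continuous_snd (X := K) (Y := K × K)).snd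
  -- Both inner products induce exactly the norm of `K`; hence definiteness, and norm equivalence
  -- with constants `1`.
  have nR : ∀ x, ‖x‖ ^ 2 = ‖R x x‖ := fun x => by
    refine hi.induction_on x (isClosed_eq (by fun_prop) (cR c1 c1).norm) fun y => ?_
    rw [hR, hn, E.normR_sq]
  have nL : ∀ x, ‖x‖ ^ 2 = ‖L x x‖ := fun x => by
    refine hi.induction_on x (isClosed_eq (by fun_prop) (cL c1 c1).norm) fun y => ?_
    rw [hL, hn, E.normR_sq, E.norm_innerL_self]
  have definite : ∀ x : K, ‖x‖ ^ 2 = 0 → x = 0 := fun x h => by simpa using h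
  have sqrtNorm : ∀ (x : K) (s : ℝ), ‖x‖ ^ 2 = s → 1 * ‖x‖ ≤ √s ∧ √s ≤ 1 * ‖x‖ := fun x s h => by
    rw [← h, Real.sqrt_sq (norm_nonneg x), one_mul]
    exact ⟨le_rfl, le_rfl⟩
  refine ⟨{ carrier := K, lsmul := l, rsmul := r, innerL := L, innerR := R
            mul_lsmul := fun a a' m => ?_, rsmul_mul := fun m b b' => ?_
            lsmul_rsmul := fun a m b => ?_, lsmul_dense := ?_, rsmul_dense := ?_
            innerL_lsmul := fun a m n => ?_, star_innerL := fun m n => ?_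
            innerL_self_nonneg := fun m => ?_
            innerL_self_eq_zero := fun m h => definite m (by rw [nL, h, norm_zero])
            innerR_rsmul := fun m n b => ?_, star_innerR := fun m n => ?_
            innerR_self_nonneg := fun m => ?_
            innerR_self_eq_zero := fun m h => definite m (by rw [nR, h, norm_zero])
            innerR_lsmul := fun a m n => ?_, innerL_rsmul := fun m n b => ?_
            normL_equiv := ⟨1, 1, one_pos, one_pos, fun m => sqrtNorm m _ (nL m)⟩
            normR_equiv := ⟨1, 1, one_pos, one_pos, fun m => sqrtNorm m _ (nR m)⟩
            innerL_assoc := fun m n x => ?_ }, i, hi, fun a x => (hl a x).symm,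
          fun x b => (hr x b).symm, hL, hR⟩
  · refine hi.induction_on m (isClosed_eq (cl continuous_const c1)
      (cl continuous_const (cl continuous_const c1))) fun x => ?_
    simp [hl, E.mul_lsmul]
  · refine hi.induction_on m (isClosed_eq (cr c1 continuous_const)
      (cr (cr c1 continuous_const) continuous_const)) fun x => ?_
    simp [hr, E.rsmul_mul]
  · refine hi.induction_on m (isClosed_eq (cr (cl continuous_const c1) continuous_const)
      (cl continuous_const (cr c1 continuous_const))) fun x => ?_
    simp [hr, hl, E.lsmul_rsmul]
  · rw [← dense_closure]
    refine hi.mono ?_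
    rintro _ ⟨x, rfl⟩
    refine Metric.mem_closure_iff.mpr fun ε hε => ?_
    obtain ⟨a, ha⟩ := E.exists_lsmul_near x hε
    exact ⟨l a (i x), Submodule.subset_span ⟨a, _, rfl⟩, by
      rwa [dist_eq_norm, hl, ← map_sub, hn]⟩
  · rw [← dense_closure]
    refine hi.mono ?_
    rintro _ ⟨x, rfl⟩
    refine Metric.mem_closure_iff.mpr fun ε hε => ?_
    obtain ⟨b, hb⟩ := E.exists_rsmul_near x hε
    exact ⟨r (i x) b, Submodule.subset_span ⟨_, b, rfl⟩, by
      rwa [dist_eq_norm, hr, ← map_sub, hn]⟩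
  · refine hi.induction_on₂ (isClosed_eq (cL (cl continuous_const d1) d2)
      (continuous_const.mul (cL d1 d2))) (fun x y => ?_) m n
    simp [hl, hL, E.innerL_lsmul]
  · refine hi.induction_on₂ (isClosed_eq (cL d1 d2).star (cL d2 d1)) (fun x y => ?_) m n
    simp [hL, E.star_innerL]
  · refine hi.induction_on m (isClosed_le continuous_const (cL c1 c1)) fun x => ?_
    rw [hL]
    exact E.innerL_self_nonneg x
  · refine hi.induction_on₂ (isClosed_eq (cR d1 (cr d2 continuous_const))
      ((cR d1 d2).mul continuous_const)) (fun x y => ?_) m n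
    simp [hr, hR, E.innerR_rsmul]
  · refine hi.induction_on₂ (isClosed_eq (cR d1 d2).star (cR d2 d1)) (fun x y => ?_) m n
    simp [hR, E.star_innerR]
  · refine hi.induction_on m (isClosed_le continuous_const (cR c1 c1)) fun x => ?_
    rw [hR]
    exact E.innerR_self_nonneg x
  · refine hi.induction_on₂ (isClosed_eq (cR (cl continuous_const d1) d2)
      (cR d1 (cl continuous_const d2))) (fun x y => ?_) m n
    simp [hl, hR, E.innerR_lsmul]
  · refine hi.induction_on₂ (isClosed_eq (cL (cr d1 continuous_const) d2)
      (cL d1 (cr d2 continuous_const))) (fun x y => ?_) m n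
    simp [hr, hL, E.innerL_rsmul]
  -- The two sides of the associativity law differ by a null vector, which `i` sends to zero.
  · have key : ∀ x y z, i (E.lsmul (E.innerL x y) z) = i (E.rsmul x (E.innerR y z)) := by
      intro x y z
      rw [← sub_eq_zero, ← map_sub]
      refine definite _ ?_
      rw [hn, E.normR_sq, map_sub, E.innerR_assoc, sub_self, norm_zero]
    refine hi.induction_on₃ (isClosed_eq (cl (cL t1 t2) t3) (cr t1 (cR t2 t3)))
      (fun x y z => ?_) m n x
    rw [hL, hR, hl, hr, key]

end PreHilbertBimodule

/-! ### Norm estimates for Hilbert bimodules and a criterion for isomorphism -/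

namespace HilbertBimodule

variable {A : Type u₁} {B : Type u₂}
  [NonUnitalCStarAlgebra A] [PartialOrder A] [StarOrderedRing A]
  [NonUnitalCStarAlgebra B] [PartialOrder B] [StarOrderedRing B]

/-- The algebraic structure underlying a Hilbert bimodule. -/
abbrev toPre (M : HilbertBimodule.{u₁, u₂, v} A B) : PreHilbertBimodule.{u₁, u₂, v} A B where
  carrier := M.carrier
  lsmul := M.lsmul
  rsmul := M.rsmul
  innerL := M.innerL
  innerR := M.innerR
  mul_lsmul := M.mul_lsmul
  rsmul_mul := M.rsmul_mul
  lsmul_rsmul := M.lsmul_rsmul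
  innerL_lsmul := M.innerL_lsmul
  star_innerL := M.star_innerL
  innerL_self_nonneg := M.innerL_self_nonneg
  innerR_rsmul := M.innerR_rsmul
  star_innerR := M.star_innerR
  innerR_self_nonneg := M.innerR_self_nonneg
  innerR_lsmul := M.innerR_lsmul
  innerL_rsmul := M.innerL_rsmul
  innerR_assoc z m n r := by rw [M.innerL_assoc]
  innerL_assoc z m n r := by rw [M.innerL_assoc]

variable (M : HilbertBimodule.{u₁, u₂, v} A B)

theorem innerL_lsmul_right (a : A) (m n : M) :
    M.innerL m (M.lsmul a n) = M.innerL m n * star a := by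
  rw [← M.star_innerL, M.innerL_lsmul, star_mul, M.star_innerL]

theorem innerR_rsmul_left (m n : M) (b : B) :
    M.innerR (M.rsmul m b) n = star b * M.innerR m n := M.toPre.innerR_rsmul_left m n b

theorem innerL_ext {x y : M} (h : ∀ z, M.innerL x z = M.innerL y z) : x = y := by
  rw [← sub_eq_zero]
  refine M.innerL_self_eq_zero _ ?_
  rw [LinearMap.map_sub₂, h, sub_self]

theorem innerR_ext {x y : M} (h : ∀ z, M.innerR x z = M.innerR y z) : x = y := by
  rw [← sub_eq_zero]
  refine M.innerR_self_eq_zero _ ?_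
  rw [LinearMap.map_sub₂, h, sub_self]

theorem exists_normR_le : ∃ C : ℝ, 0 < C ∧ ∀ m : M, M.toPre.normR m ≤ C * ‖m‖ := by
  obtain ⟨_, C, _, hC, h⟩ := M.normR_equiv
  exact ⟨C, hC, fun m => (h m).2⟩

theorem exists_le_normR : ∃ C : ℝ, 0 < C ∧ ∀ m : M, ‖m‖ ≤ C * M.toPre.normR m := by
  obtain ⟨c, _, hc, _, h⟩ := M.normR_equiv
  exact ⟨c⁻¹, by positivity, fun m => (le_inv_mul_iff₀ hc).mpr (h m).1⟩

theorem exists_lsmul_near (x : M) {ε : ℝ} (hε : 0 < ε) : ∃ a : A, ‖x - M.lsmul a x‖ < ε := by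
  obtain ⟨C, hC, h⟩ := M.exists_le_normR
  obtain ⟨a, ha⟩ := M.toPre.exists_lsmul_near x (div_pos hε hC)
  exact ⟨a, (h _).trans_lt ((lt_div_iff₀' hC).mp ha)⟩

theorem exists_rsmul_near (x : M) {ε : ℝ} (hε : 0 < ε) : ∃ b : B, ‖x - M.rsmul x b‖ < ε := by
  obtain ⟨C, hC, h⟩ := M.exists_le_normR
  obtain ⟨b, hb⟩ := M.toPre.exists_rsmul_near x (div_pos hε hC)
  exact ⟨b, (h _).trans_lt ((lt_div_iff₀' hC).mp hb)⟩

variable {X : Type v} [TopologicalSpace X]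

theorem continuous_innerL {p q : X → M} (hp : Continuous p) (hq : Continuous q) :
    Continuous fun x => M.innerL (p x) (q x) := by
  obtain ⟨C, hC, h⟩ := M.exists_normR_le
  obtain ⟨g, cg, hg⟩ := LinearMap.exists_extend₂.{v} M.innerL (i := LinearMap.id)
    (j := LinearMap.id) Function.surjective_id.denseRange Function.surjective_id.denseRange
    (mul_nonneg hC.le hC.le) fun x y => calc
      ‖M.innerL x y‖ ≤ M.toPre.normR x * M.toPre.normR y := M.toPre.norm_innerL_le x y
      _ ≤ (C * ‖x‖) * (C * ‖y‖) :=
        mul_le_mul (h x) (h y) (M.toPre.normR_nonneg y) (by positivity)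
      _ = C * C * ‖x‖ * ‖y‖ := by ring
  exact (cg hp hq).congr fun x => hg _ _

theorem continuous_innerR {p q : X → M} (hp : Continuous p) (hq : Continuous q) :
    Continuous fun x => M.innerR (p x) (q x) := by
  obtain ⟨C, hC, h⟩ := M.exists_normR_le
  obtain ⟨g, cg, hg⟩ := LinearMap.exists_extend₂.{v} M.innerR (i := LinearMap.id)
    (j := LinearMap.id) Function.surjective_id.denseRange Function.surjective_id.denseRange
    (mul_nonneg hC.le hC.le) fun x y => calc
      ‖M.innerR x y‖ ≤ M.toPre.normR x * M.toPre.normR y := M.toPre.norm_innerR_le x y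
      _ ≤ (C * ‖x‖) * (C * ‖y‖) :=
        mul_le_mul (h x) (h y) (M.toPre.normR_nonneg y) (by positivity)
      _ = C * C * ‖x‖ * ‖y‖ := by ring
  exact (cg hp hq).congr fun x => hg _ _

theorem exists_norm_lsmul_le : ∃ C : ℝ, 0 < C ∧ ∀ a (m : M), ‖M.lsmul a m‖ ≤ C * ‖a‖ * ‖m‖ := by
  obtain ⟨C, hC, h⟩ := M.exists_normR_le
  obtain ⟨D, hD, h'⟩ := M.exists_le_normR
  refine ⟨D * C, by positivity, fun a m => ?_⟩
  calc ‖M.lsmul a m‖ ≤ D * M.toPre.normR (M.lsmul a m) := h' _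
    _ ≤ D * (‖a‖ * M.toPre.normR m) := by gcongr; exact M.toPre.normR_lsmul_le a m
    _ ≤ D * (‖a‖ * (C * ‖m‖)) := by gcongr; exact h m
    _ = D * C * ‖a‖ * ‖m‖ := by ring

/-- The map `f x ↦ g x` preserves the seminorms of the inner products, so it extends to a
homeomorphism `e`. Nothing is assumed about the actions: `⟨e (a m), e z⟩ = a ⟨m, z⟩ = ⟨a e m, e z⟩`
for all `z`, and `e` is surjective, so `e` respects them automatically. -/
theorem isomorphic_of_denseRange {E : Type*} [AddCommGroup E] [Module ℂ E]
    {P : HilbertBimodule.{u₁, u₂, v₁} A B} {Q : HilbertBimodule.{u₁, u₂, v₂} A B}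
    (f : E →ₗ[ℂ] P) (g : E →ₗ[ℂ] Q) (hf : DenseRange f) (hg : DenseRange g)
    (hL : ∀ x y, P.innerL (f x) (f y) = Q.innerL (g x) (g y))
    (hR : ∀ x y, P.innerR (f x) (f y) = Q.innerR (g x) (g y)) : Isomorphic P Q := by
  have hn : ∀ x, P.toPre.normR (f x) = Q.toPre.normR (g x) := fun x => by
    change √‖P.innerR (f x) (f x)‖ = √‖Q.innerR (g x) (g x)‖
    rw [hR]
  have h1 : ∃ C, ∀ x, ‖g (LinearEquiv.refl ℂ E x)‖ ≤ C * ‖f x‖ := by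
    obtain ⟨C, hC, h⟩ := P.exists_normR_le
    obtain ⟨D, hD, h'⟩ := Q.exists_le_normR
    refine ⟨D * C, fun x => (h' _).trans ?_⟩
    rw [mul_assoc]
    refine mul_le_mul_of_nonneg_left ((hn x).symm.trans_le (h _)) hD.le
  have h2 : ∃ C, ∀ x, ‖f ((LinearEquiv.refl ℂ E).symm x)‖ ≤ C * ‖g x‖ := by
    obtain ⟨C, hC, h⟩ := Q.exists_normR_le
    obtain ⟨D, hD, h'⟩ := P.exists_le_normR
    refine ⟨D * C, fun x => (h' _).trans ?_⟩
    rw [mul_assoc]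
    refine mul_le_mul_of_nonneg_left ((hn x).trans_le (h _)) hD.le
  let e := (LinearEquiv.refl ℂ E).extend f g hf h1 hg h2
  have he : ∀ x, e (f x) = g x := fun x => LinearMap.extendOfNorm_eq hf h1 x
  have hec : Continuous e := e.continuous
  have eL : ∀ x y, Q.innerL (e x) (e y) = P.innerL x y := fun x y => by
    refine hf.induction_on₂ (p := fun x y => Q.innerL (e x) (e y) = P.innerL x y)
      (isClosed_eq ?_ (P.continuous_innerL continuous_fst continuous_snd)) (fun x y => ?_) x y
    · exact (Q.continuous_innerL continuous_fst continuous_snd).comp (hec.prodMap hec)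
    · rw [he, he, hL]
  have eR : ∀ x y, Q.innerR (e x) (e y) = P.innerR x y := fun x y => by
    refine hf.induction_on₂ (p := fun x y => Q.innerR (e x) (e y) = P.innerR x y)
      (isClosed_eq ?_ (P.continuous_innerR continuous_fst continuous_snd)) (fun x y => ?_) x y
    · exact (Q.continuous_innerR continuous_fst continuous_snd).comp (hec.prodMap hec)
    · rw [he, he, hR]
  refine ⟨e.toLinearEquiv, fun a m => Q.innerL_ext fun z => ?_, fun m b => Q.innerR_ext fun z => ?_,
    eL, eR⟩
  · obtain ⟨z, rfl⟩ := e.surjective z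
    rw [Q.innerL_lsmul]
    exact (eL _ _).trans ((P.innerL_lsmul _ _ _).trans (congrArg _ (eL _ _).symm))
  · obtain ⟨z, rfl⟩ := e.surjective z
    rw [Q.innerR_rsmul_left]
    exact (eR _ _).trans ((P.innerR_rsmul_left _ _ _).trans (congrArg _ (eR _ _).symm))

end HilbertBimodule

/-! ### The conjugate Hilbert bimodule -/

namespace ConjSpace

variable {E : Type v}

instance [NormedAddCommGroup E] : NormedAddCommGroup (ConjSpace E) :=
  inferInstanceAs (NormedAddCommGroup E)

instance [NormedAddCommGroup E] [CompleteSpace E] : CompleteSpace (ConjSpace E) :=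
  inferInstanceAs (CompleteSpace E)

instance [NormedAddCommGroup E] [NormedSpace ℂ E] : NormedSpace ℂ (ConjSpace E) where
  __ := (inferInstance : Module ℂ (ConjSpace E))
  norm_smul_le c x := by
    have := norm_smul_le ((starRingEnd ℂ) c) (of.symm x)
    rwa [RCLike.norm_conj] at this

end ConjSpace

namespace HilbertBimodule

variable {A : Type u₁} {B : Type u₂} {C : Type u₃}
  [NonUnitalCStarAlgebra A] [PartialOrder A] [StarOrderedRing A]
  [NonUnitalCStarAlgebra B] [PartialOrder B] [StarOrderedRing B]
  [NonUnitalCStarAlgebra C] [PartialOrder C] [StarOrderedRing C]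

/-- The conjugate Hilbert bimodule. -/
def dual (M : HilbertBimodule.{u₁, u₂, v} A B) : HilbertBimodule.{u₂, u₁, v} B A where
  carrier := ConjSpace M.carrier
  lsmul := LinearMap.mk₂ ℂ
    (fun (b : B) (m : ConjSpace M.carrier) => ConjSpace.of (M.rsmul (ConjSpace.of.symm m) (star b)))
    (by simp) (by simp) (by simp) (by simp)
  rsmul := LinearMap.mk₂ ℂ
    (fun (m : ConjSpace M.carrier) (a : A) => ConjSpace.of (M.lsmul (star a) (ConjSpace.of.symm m)))
    (by simp) (by simp) (by simp) (by simp)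
  innerL := LinearMap.mk₂'ₛₗ (RingHom.id ℂ) (starRingEnd ℂ)
    (fun m n : ConjSpace M.carrier => M.innerR (ConjSpace.of.symm m) (ConjSpace.of.symm n))
    (by simp) (by simp) (by simp) (by simp)
  innerR := LinearMap.mk₂'ₛₗ (starRingEnd ℂ) (RingHom.id ℂ)
    (fun m n : ConjSpace M.carrier => M.innerL (ConjSpace.of.symm m) (ConjSpace.of.symm n))
    (by simp) (by simp) (by simp) (by simp)
  mul_lsmul := M.toPre.dual.mul_lsmul
  rsmul_mul := M.toPre.dual.rsmul_mul
  lsmul_rsmul := M.toPre.dual.lsmul_rsmul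
  lsmul_dense x := by
    refine Metric.mem_closure_iff.mpr fun ε hε => ?_
    obtain ⟨b, hb⟩ := M.exists_rsmul_near (ConjSpace.of.symm x) hε
    refine ⟨_, Submodule.subset_span ⟨star b, x, rfl⟩, ?_⟩
    rw [dist_eq_norm, LinearMap.mk₂_apply, star_star]
    exact hb
  rsmul_dense x := by
    refine Metric.mem_closure_iff.mpr fun ε hε => ?_
    obtain ⟨a, ha⟩ := M.exists_lsmul_near (ConjSpace.of.symm x) hε
    refine ⟨_, Submodule.subset_span ⟨x, star a, rfl⟩, ?_⟩
    rw [dist_eq_norm, LinearMap.mk₂_apply, star_star]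
    exact ha
  innerL_lsmul := M.toPre.dual.innerL_lsmul
  star_innerL := M.toPre.dual.star_innerL
  innerL_self_nonneg := M.toPre.dual.innerL_self_nonneg
  innerL_self_eq_zero := M.innerR_self_eq_zero
  innerR_rsmul := M.toPre.dual.innerR_rsmul
  star_innerR := M.toPre.dual.star_innerR
  innerR_self_nonneg := M.toPre.dual.innerR_self_nonneg
  innerR_self_eq_zero := M.innerL_self_eq_zero
  innerR_lsmul := M.toPre.dual.innerR_lsmul
  innerL_rsmul := M.toPre.dual.innerL_rsmul
  normL_equiv := M.normR_equiv
  normR_equiv := M.normL_equiv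
  innerL_assoc m n r := by
    have := M.innerL_assoc (ConjSpace.of.symm r) (ConjSpace.of.symm n) (ConjSpace.of.symm m)
    simp [M.star_innerL, M.star_innerR, this]

variable (M : HilbertBimodule.{u₁, u₂, v} A B)

/-! ### Positivity of the tensor product form -/

/-- Finitely many elements of a Hilbert module are almost fixed by some `∑ ⟨x, x⟩`. -/
theorem exists_sum_innerL_near {ι : Type*} (s : Finset ι) (m : ι → M) {ε : ℝ} (hε : 0 < ε) :
    ∃ x : ι → M, ∀ i ∈ s, ‖m i - M.lsmul (∑ k ∈ s, M.innerL (x k) (x k)) (m i)‖ < ε := by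
  suffices h : ∀ δ : ℝ, 0 < δ → ∃ x : ι → M, ∀ i ∈ s,
      M.toPre.normR (m i - M.lsmul (∑ k ∈ s, M.innerL (x k) (x k)) (m i)) ^ 2 ≤ δ by
    obtain ⟨D, hD, h'⟩ := M.exists_le_normR
    obtain ⟨x, hx⟩ := h ((ε / (2 * D)) ^ 2) (by positivity)
    refine ⟨x, fun i hi => (h' _).trans_lt ?_⟩
    have := abs_le_of_sq_le_sq' (hx i hi) (by positivity) |>.2
    calc _ ≤ D * (ε / (2 * D)) := by gcongr
      _ = ε / 2 := by field_simp
      _ < ε := by linarith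
  intro δ hδ
  set h := ∑ k ∈ s, M.innerL (m k) (m k) with hh
  have h0 : 0 ≤ h := Finset.sum_nonneg fun k _ => M.innerL_self_nonneg _
  have hsa : IsSelfAdjoint h := h0.isSelfAdjoint
  -- With `x k = g(h) m k`, the sum `∑ ⟨x k, x k⟩` is `g(h) h g(h) = F(h)`, and `F t = t² / (t +
  -- δ)²` is near `1` where `t` is large compared with `δ`. The absolute value keeps the denominator
  -- positive on all of `ℝ`.
  let g : ℝ → ℝ := fun t => √t / (|t| + δ)
  have hg : Continuous g := by
    refine Real.continuous_sqrt.div (by fun_prop) fun t => ?_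
    positivity
  have hg0 : g 0 = 0 := by simp [g]
  let F : ℝ → ℝ := fun t => g t * t * g t
  have hF : Continuous F := by fun_prop
  have hF0 : F 0 = 0 := by simp [F]
  have hid : cfcₙ (fun t : ℝ => t) h = h := cfcₙ_id' ℝ h
  set q := cfcₙ g h with hq
  have hqs : star q = q := (cfcₙ_predicate g h).star_eq
  have hp : ∑ k ∈ s, M.innerL (M.lsmul q (m k)) (M.lsmul q (m k)) = cfcₙ F h := by
    simp only [M.innerL_lsmul, M.innerL_lsmul_right, hqs, ← Finset.mul_sum, ← Finset.sum_mul]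
    rw [← hh, cfcₙ_mul _ _ _ (by fun_prop) (by simp) (by fun_prop) hg0,
      cfcₙ_mul _ _ _ (by fun_prop) hg0, hid, mul_assoc]
  refine ⟨fun k => M.lsmul q (m k), fun i hi => ?_⟩
  rw [hp, M.toPre.normR_sq, ← M.toPre.norm_innerL_self]
  set p := cfcₙ F h with hpF
  have hps : star p = p := (cfcₙ_predicate F h).star_eq
  have e : ∀ k, M.innerL (m k - M.lsmul p (m k)) (m k - M.lsmul p (m k))
      = M.innerL (m k) (m k) - p * M.innerL (m k) (m k)
        - (M.innerL (m k) (m k) * p - p * M.innerL (m k) (m k) * p) := fun k => by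
    rw [LinearMap.map_sub₂, map_sub, map_sub, M.innerL_lsmul, M.innerL_lsmul, M.innerL_lsmul_right,
      hps, mul_assoc]
    abel
  -- A single inner square is at most the sum of all of them, which is `(1 - p) h (1 - p)`, a
  -- function of `h` alone.
  have hle : M.innerL (m i - M.lsmul p (m i)) (m i - M.lsmul p (m i)) ≤
      h - p * h - (h * p - p * h * p) := by
    have h1 := Finset.single_le_sum
      (f := fun k => M.innerL (m k - M.lsmul p (m k)) (m k - M.lsmul p (m k)))
      (fun k _ => M.innerL_self_nonneg _) hi
    refine h1.trans_eq ?_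
    simp only [e, Finset.sum_sub_distrib, ← Finset.mul_sum, ← Finset.sum_mul]
    rw [hh]
  refine (CStarAlgebra.norm_le_norm_of_nonneg_of_le (M.innerL_self_nonneg _) hle).trans ?_
  have hc : h - p * h - (h * p - p * h * p) =
      cfcₙ (fun t => t - F t * t - (t * F t - F t * t * F t)) h := by
    rw [cfcₙ_sub _ _ _ (by fun_prop) (by simp) (by fun_prop) (by simp),
      cfcₙ_sub _ _ _ (by fun_prop) (by simp) (by fun_prop) (by simp),
      cfcₙ_sub _ _ _ (by fun_prop) (by simp) (by fun_prop) (by simp),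
      cfcₙ_mul _ _ _ (by fun_prop) (by simp) (by fun_prop) hF0,
      cfcₙ_mul _ _ _ (by fun_prop) hF0 (by fun_prop) (by simp),
      cfcₙ_mul _ _ _ (by fun_prop) (by simp) (by fun_prop) hF0,
      cfcₙ_mul _ _ _ (by fun_prop) hF0 (by fun_prop) (by simp), hid]
  rw [hc]
  refine norm_cfcₙ_le fun t ht => ?_
  have ht0 : 0 ≤ t := quasispectrum_nonneg_of_nonneg h h0 t ht
  have hFt : F t = t ^ 2 / (t + δ) ^ 2 := by
    simp only [F, g, abs_of_nonneg ht0]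
    field_simp
    rw [Real.sq_sqrt ht0, sq]
  have h2 : t - F t * t - (t * F t - F t * t * F t) = t * (δ * (2 * t + δ) / (t + δ) ^ 2) ^ 2 := by
    rw [hFt]
    field_simp
    ring
  rw [h2, Real.norm_of_nonneg (by positivity), div_pow, mul_div_assoc', div_le_iff₀ (by positivity)]
  -- The bound `t (1 - F t)² ≤ δ` rests on `2t + δ ≤ 2(t + δ)` and `4tδ ≤ (t + δ)²`.
  have h3 : δ * (2 * t + δ) ≤ 2 * δ * (t + δ) := by nlinarith
  calc t * (δ * (2 * t + δ)) ^ 2 ≤ t * (2 * δ * (t + δ)) ^ 2 := by gcongr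
    _ = δ * (4 * t * δ) * (t + δ) ^ 2 := by ring
    _ ≤ δ * (t + δ) ^ 2 * (t + δ) ^ 2 := by
      gcongr
      nlinarith [sq_nonneg (t - δ)]
    _ = δ * ((t + δ) ^ 2) ^ 2 := by ring

/-- Positivity of the right inner product of an interior tensor product. -/
theorem sum_innerR_lsmul_innerR_nonneg (N : HilbertBimodule.{u₂, u₃, v} B C) {ι : Type*}
    (s : Finset ι) (m : ι → M) (n : ι → N) :
    0 ≤ ∑ i ∈ s, ∑ j ∈ s, N.innerR (n i) (N.lsmul (M.innerR (m i) (m j)) (n j)) := by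
  obtain ⟨D, hD, h'⟩ := N.exists_norm_lsmul_le
  -- Replace `m j` by `p k` applied to `m j`, with `p k = ∑ ⟨x k l, x k l⟩`. Then `⟨m i, m j⟩`
  -- becomes `∑ ⟨m i, x k l⟩⟨x k l, m j⟩`, and the double sum becomes `∑ ⟨y l, y l⟩` with `y l = ∑
  -- ⟨x k l, m i⟩ n i`. The limit of these positive elements is positive.
  choose x hx using fun k : ℕ =>
    M.exists_sum_innerL_near s m (Nat.one_div_pos_of_nat (α := ℝ) (n := k))
  set p : ℕ → A := fun k => ∑ l ∈ s, M.innerL (x k l) (x k l) with hp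
  have hpm : ∀ i ∈ s, Filter.Tendsto (fun k => M.lsmul (p k) (m i)) Filter.atTop (nhds (m i)) := by
    intro i hi
    rw [tendsto_iff_norm_sub_tendsto_zero]
    refine squeeze_zero (fun k => norm_nonneg _) (fun k => ?_)
      tendsto_one_div_add_atTop_nhds_zero_nat
    rw [norm_sub_rev]
    exact (hx k i hi).le
  have hc : ∀ i j, Continuous fun y : M => N.innerR (n i) (N.lsmul (M.innerR (m i) y) (n j)) := by
    intro i j
    have h1 : Continuous fun b : B => N.lsmul b (n j) :=
      AddMonoidHomClass.continuous_of_bound (N.lsmul.flip (n j)) (D * ‖n j‖) fun b => by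
        simpa [mul_right_comm] using h' b (n j)
    have h2 : Continuous fun y : N => N.innerR (n i) y :=
      N.continuous_innerR continuous_const continuous_id
    exact h2.comp (h1.comp (M.continuous_innerR continuous_const continuous_id))
  refine ge_of_tendsto (tendsto_finsetSum s fun i _ => tendsto_finsetSum s fun j hj =>
    ((hc i j).tendsto (m j)).comp (hpm j hj)) (Filter.Eventually.of_forall fun k => ?_)
  have e : ∀ i j, N.innerR (n i) (N.lsmul (M.innerR (m i) (M.lsmul (p k) (m j))) (n j)) =
      ∑ l ∈ s, N.innerR (N.lsmul (M.innerR (x k l) (m i)) (n i))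
        (N.lsmul (M.innerR (x k l) (m j)) (n j)) := by
    intro i j
    simp only [hp, map_sum, LinearMap.sum_apply]
    refine Finset.sum_congr rfl fun l _ => ?_
    rw [M.innerL_assoc, M.innerR_rsmul, N.mul_lsmul, N.innerR_lsmul, M.star_innerR]
  simp only [Function.comp_def, e]
  have e2 : ∑ i ∈ s, ∑ j ∈ s, ∑ l ∈ s, N.innerR (N.lsmul (M.innerR (x k l) (m i)) (n i))
        (N.lsmul (M.innerR (x k l) (m j)) (n j)) =
      ∑ l ∈ s, N.innerR (∑ i ∈ s, N.lsmul (M.innerR (x k l) (m i)) (n i))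
        (∑ i ∈ s, N.lsmul (M.innerR (x k l) (m i)) (n i)) := by
    simp only [map_sum, LinearMap.sum_apply]
    rw [Finset.sum_congr rfl fun i _ => Finset.sum_comm, Finset.sum_comm]
    exact Finset.sum_congr rfl fun l _ => Finset.sum_comm
  rw [e2]
  exact Finset.sum_nonneg fun l _ => N.innerR_self_nonneg _

end HilbertBimodule

/-! ### The algebraic tensor product as a pre-Hilbert bimodule -/

open scoped TensorProduct in
theorem LinearMap.range_lift_eq_span {M N P : Type*} [AddCommGroup M] [Module ℂ M]
    [AddCommGroup N] [Module ℂ N] [AddCommGroup P] [Module ℂ P] (t : M →ₗ[ℂ] N →ₗ[ℂ] P) :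
    Set.range (TensorProduct.lift t) =
      (Submodule.span ℂ {x : P | ∃ m n, x = t m n} : Set P) := by
  rw [← LinearMap.coe_range, LinearMap.range_eq_map, ← TensorProduct.span_tmul_eq_top,
    Submodule.map_span]
  congr 2
  ext x
  constructor
  · rintro ⟨_, ⟨m, n, rfl⟩, rfl⟩
    exact ⟨m, n, TensorProduct.lift.tmul _ _⟩
  · rintro ⟨m, n, rfl⟩
    exact ⟨_, ⟨m, n, rfl⟩, TensorProduct.lift.tmul _ _⟩

namespace HilbertBimodule

open scoped TensorProduct

variable {A : Type u₁} {B : Type u₂} {C : Type u₃}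
  [NonUnitalCStarAlgebra A] [PartialOrder A] [StarOrderedRing A]
  [NonUnitalCStarAlgebra B] [PartialOrder B] [StarOrderedRing B]
  [NonUnitalCStarAlgebra C] [PartialOrder C] [StarOrderedRing C]

section Tensor

variable (M : HilbertBimodule.{u₁, u₂, v} A B) (N : HilbertBimodule.{u₂, u₃, v} B C)

/-- The left inner product on the algebraic tensor product. -/
noncomputable def tensorInnerL : M ⊗[ℂ] N →ₗ[ℂ] M ⊗[ℂ] N →ₗ⋆[ℂ] A :=
  TensorProduct.lift (LinearMap.mk₂ ℂ
    (fun (m : M) (n : N) => (TensorProduct.lift (LinearMap.mk₂'ₛₗ (starRingEnd ℂ) (starRingEnd ℂ)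
      (fun (m' : M) (n' : N) => M.innerL m (M.rsmul m' (N.innerL n' n)))
      (by simp) (by simp) (by simp) (by simp)) : M ⊗[ℂ] N →ₗ⋆[ℂ] A))
    (fun _ _ _ => TensorProduct.ext' (by simp)) (fun _ _ _ => TensorProduct.ext' (by simp))
    (fun _ _ _ => TensorProduct.ext' (by simp)) (fun _ _ _ => TensorProduct.ext' (by simp)))

/-- The right inner product on the algebraic tensor product. -/
noncomputable def tensorInnerR : M ⊗[ℂ] N →ₗ⋆[ℂ] M ⊗[ℂ] N →ₗ[ℂ] C :=
  TensorProduct.lift (LinearMap.mk₂'ₛₗ (starRingEnd ℂ) (starRingEnd ℂ)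
    (fun (m : M) (n : N) => TensorProduct.lift (LinearMap.mk₂ ℂ
      (fun (m' : M) (n' : N) => N.innerR n (N.lsmul (M.innerR m m') n'))
      (by simp) (by simp) (by simp) (by simp)))
    (fun _ _ _ => TensorProduct.ext' (by simp)) (fun _ _ _ => TensorProduct.ext' (by simp))
    (fun _ _ _ => TensorProduct.ext' (by simp)) (fun _ _ _ => TensorProduct.ext' (by simp)))

variable {M N}

@[simp]
theorem tensorInnerL_tmul (m m' : M) (n n' : N) :
    tensorInnerL M N (m ⊗ₜ n) (m' ⊗ₜ n') = M.innerL m (M.rsmul m' (N.innerL n' n)) := rfl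

@[simp]
theorem tensorInnerR_tmul (m m' : M) (n n' : N) :
    tensorInnerR M N (m ⊗ₜ n) (m' ⊗ₜ n') = N.innerR n (N.lsmul (M.innerR m m') n') := rfl

/-- The left action on the algebraic tensor product. -/
noncomputable def tensorLsmul (M : HilbertBimodule.{u₁, u₂, v} A B)
    (N : HilbertBimodule.{u₂, u₃, v} B C) : A →ₗ[ℂ] M ⊗[ℂ] N →ₗ[ℂ] M ⊗[ℂ] N :=
  LinearMap.rTensorHom N ∘ₗ M.lsmul

/-- The right action on the algebraic tensor product. -/
noncomputable def tensorRsmul (M : HilbertBimodule.{u₁, u₂, v} A B)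
    (N : HilbertBimodule.{u₂, u₃, v} B C) : M ⊗[ℂ] N →ₗ[ℂ] C →ₗ[ℂ] M ⊗[ℂ] N :=
  (LinearMap.lTensorHom M ∘ₗ N.rsmul.flip).flip

@[simp]
theorem tensorLsmul_tmul (a : A) (m : M) (n : N) :
    tensorLsmul M N a (m ⊗ₜ n) = M.lsmul a m ⊗ₜ n := rfl

@[simp]
theorem tensorRsmul_tmul (m : M) (n : N) (c : C) :
    tensorRsmul M N (m ⊗ₜ n) c = m ⊗ₜ N.rsmul n c := rfl

/-- An identity between biadditive functions on a tensor product can be checked on pure tensors. -/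
theorem tensor_induction₂ {F : Type*} [AddCommGroup F] {f g : M ⊗[ℂ] N → M ⊗[ℂ] N → F}
    (hf₁ : ∀ x x' y, f (x + x') y = f x y + f x' y)
    (hf₂ : ∀ x y y', f x (y + y') = f x y + f x y')
    (hg₁ : ∀ x x' y, g (x + x') y = g x y + g x' y)
    (hg₂ : ∀ x y y', g x (y + y') = g x y + g x y')
    (h : ∀ m n m' n', f (m ⊗ₜ n) (m' ⊗ₜ n') = g (m ⊗ₜ n) (m' ⊗ₜ n')) (x y : M ⊗[ℂ] N) :
    f x y = g x y := by
  have zero_left : ∀ {k : M ⊗[ℂ] N → M ⊗[ℂ] N → F},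
      (∀ x x' y, k (x + x') y = k x y + k x' y) → ∀ y, k 0 y = 0 := fun hk y => by
    simpa using hk 0 0 y
  have zero_right : ∀ {k : M ⊗[ℂ] N → M ⊗[ℂ] N → F},
      (∀ x y y', k x (y + y') = k x y + k x y') → ∀ x, k x 0 = 0 := fun hk x => by
    simpa using hk x 0 0
  induction x with
  | zero => rw [zero_left hf₁, zero_left hg₁]
  | add x x' hx hx' => rw [hf₁, hg₁, hx, hx']
  | tmul m n =>
    induction y with
    | zero => rw [zero_right hf₂, zero_right hg₂]
    | add y y' hy hy' => rw [hf₂, hg₂, hy, hy']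
    | tmul m' n' => exact h m n m' n'

variable (M N)

/-- The algebraic tensor product of two Hilbert bimodules. -/
noncomputable def tensorPre : PreHilbertBimodule.{u₁, u₃, v} A C where
  carrier := M ⊗[ℂ] N
  lsmul := tensorLsmul M N
  rsmul := tensorRsmul M N
  innerL := tensorInnerL M N
  innerR := tensorInnerR M N
  mul_lsmul a a' x := by
    induction x with
    | zero => simp
    | add x y hx hy => simp [hx, hy]
    | tmul m n => simp [M.mul_lsmul]
  rsmul_mul x c c' := by
    induction x with
    | zero => simp
    | add x y hx hy => simp [hx, hy]
    | tmul m n => simp [N.rsmul_mul]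
  lsmul_rsmul a x c := by
    induction x with
    | zero => simp
    | add x y hx hy => simp [hx, hy]
    | tmul m n => simp
  innerL_lsmul a := tensor_induction₂ (by simp) (by simp) (by simp [mul_add]) (by simp [mul_add])
    (by simp [M.innerL_lsmul])
  star_innerL := tensor_induction₂ (by simp) (by simp) (by simp) (by simp) fun m n m' n' => by
    simp [M.star_innerL, M.innerL_rsmul, N.star_innerL]
  innerL_self_nonneg x := by
    obtain ⟨s, rfl⟩ := TensorProduct.exists_finset x
    -- The left form on `M ⊗ N` is the right form on `N.dual ⊗ M.dual` with the tensor factors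
    -- exchanged.
    have := N.dual.sum_innerR_lsmul_innerR_nonneg M.dual s (fun i => ConjSpace.of i.2)
      (fun i => ConjSpace.of i.1)
    simp only [map_sum, LinearMap.sum_apply, tensorInnerL_tmul]
    refine this.trans_eq (Eq.trans ?_ Finset.sum_comm)
    refine Finset.sum_congr rfl fun i _ => Finset.sum_congr rfl fun j _ => ?_
    rw [← N.star_innerL]
    rfl
  innerR_rsmul x y c := tensor_induction₂ (f := fun x y => tensorInnerR M N x (tensorRsmul M N y c))
    (g := fun x y => tensorInnerR M N x y * c)
    (by simp) (by simp) (by simp [add_mul]) (by simp [add_mul])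
    (fun m n m' n' => by simp [← N.innerR_rsmul, N.lsmul_rsmul]) x y
  star_innerR := tensor_induction₂ (by simp) (by simp) (by simp) (by simp) fun m n m' n' => by
    simp [M.star_innerR, N.innerR_lsmul, N.star_innerR]
  innerR_self_nonneg x := by
    obtain ⟨s, rfl⟩ := TensorProduct.exists_finset x
    have := M.sum_innerR_lsmul_innerR_nonneg N s (fun i => i.1) (fun i => i.2)
    simp only [map_sum, LinearMap.sum_apply, tensorInnerR_tmul]
    exact this.trans_eq Finset.sum_comm
  innerR_lsmul a := tensor_induction₂ (by simp) (by simp) (by simp) (by simp)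
    (by simp [M.innerR_lsmul])
  innerL_rsmul x y c := tensor_induction₂
    (f := fun x y => tensorInnerL M N (tensorRsmul M N x c) y)
    (g := fun x y => tensorInnerL M N x (tensorRsmul M N y (star c)))
    (by simp) (by simp) (by simp) (by simp)
    (fun m n m' n' => by
      simp only [tensorInnerL_tmul, tensorRsmul_tmul]
      rw [N.innerL_rsmul, star_star]) x y
  -- On pure tensors, associativity in `M` and in `N` reduces both sides to `⟨n, ⟨m, p⟩⟨q, q'⟩⟨p',
  -- m'⟩ n'⟩`.
  innerR_assoc z x y w := tensor_induction₂
    (f := fun z w => tensorInnerR M N z (tensorLsmul M N (tensorInnerL M N x y) w))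
    (g := fun z w => tensorInnerR M N z (tensorRsmul M N x (tensorInnerR M N y w)))
    (by simp) (by simp) (by simp) (by simp) (fun m n m' n' => tensor_induction₂
      (f := fun x y => tensorInnerR M N (m ⊗ₜ n) (tensorLsmul M N (tensorInnerL M N x y) (m' ⊗ₜ n')))
      (g := fun x y => tensorInnerR M N (m ⊗ₜ n) (tensorRsmul M N x (tensorInnerR M N y (m' ⊗ₜ n'))))
      (by simp) (by simp) (by simp) (by simp) (fun p q p' q' => by
        simp only [tensorInnerL_tmul, tensorLsmul_tmul, tensorRsmul_tmul, tensorInnerR_tmul]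
        rw [M.innerL_assoc, M.innerR_rsmul, M.innerR_rsmul_left, N.star_innerL, ← N.innerL_assoc,
          ← N.mul_lsmul, ← N.mul_lsmul, mul_assoc]) x y) z w
  innerL_assoc z x y w := tensor_induction₂
    (f := fun z w => tensorInnerL M N z (tensorLsmul M N (tensorInnerL M N x y) w))
    (g := fun z w => tensorInnerL M N z (tensorRsmul M N x (tensorInnerR M N y w)))
    (by simp) (by simp) (by simp) (by simp) (fun m n m' n' => tensor_induction₂
      (f := fun x y => tensorInnerL M N (m ⊗ₜ n) (tensorLsmul M N (tensorInnerL M N x y) (m' ⊗ₜ n')))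
      (g := fun x y => tensorInnerL M N (m ⊗ₜ n) (tensorRsmul M N x (tensorInnerR M N y (m' ⊗ₜ n'))))
      (by simp) (by simp) (by simp) (by simp) (fun p q p' q' => by
        simp only [tensorInnerL_tmul, tensorLsmul_tmul, tensorRsmul_tmul, tensorInnerR_tmul]
        rw [M.innerL_assoc, M.innerR_rsmul_left, N.star_innerL, ← N.innerL_assoc,
          N.innerL_lsmul, N.innerL_lsmul, ← M.rsmul_mul, mul_assoc]) x y) z w

end Tensor

end HilbertBimodule

/-! ### Existence, uniqueness and invariance of the interior tensor product -/

namespace HilbertBimodule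

open scoped TensorProduct

section Interior

variable {A : Type u₁} {B : Type u₂} {C : Type u₃}
  [NonUnitalCStarAlgebra A] [PartialOrder A] [StarOrderedRing A]
  [NonUnitalCStarAlgebra B] [PartialOrder B] [StarOrderedRing B]
  [NonUnitalCStarAlgebra C] [PartialOrder C] [StarOrderedRing C]

/-- The algebraic tensor product is taken over `ℂ` only. Balancedness holds after completion because
`m b ⊗ n - m ⊗ b n` is orthogonal to every tensor, hence null. -/
theorem exists_isInteriorTensor (M : HilbertBimodule.{u₁, u₂, v} A B)
    (N : HilbertBimodule.{u₂, u₃, v} B C) :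
    ∃ P : HilbertBimodule.{u₁, u₃, v} A C, IsInteriorTensor M N P := by
  obtain ⟨P, i, hi, hl, hr, hL, hR⟩ :
      ∃ (P : HilbertBimodule.{u₁, u₃, v} A C) (i : M ⊗[ℂ] N →ₗ[ℂ] P), DenseRange i ∧
        (∀ a x, i (tensorLsmul M N a x) = P.lsmul a (i x)) ∧
        (∀ x c, i (tensorRsmul M N x c) = P.rsmul (i x) c) ∧
        (∀ x y, P.innerL (i x) (i y) = tensorInnerL M N x y) ∧
        (∀ x y, P.innerR (i x) (i y) = tensorInnerR M N x y) :=
    (tensorPre M N).exists_completion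
  let t : M →ₗ[ℂ] N →ₗ[ℂ] P := (TensorProduct.mk ℂ M N).compr₂ i
  have ht : TensorProduct.lift t = i := TensorProduct.ext' fun m n => by simp [t]
  refine ⟨P, t, fun m b n => ?_, fun a m n => ?_, fun m n c => ?_, fun m n m' n' => ?_,
    fun m n m' n' => ?_, ?_⟩
  · have h : ∀ w, tensorInnerR M N (M.rsmul m b ⊗ₜ n) w
        = tensorInnerR M N (m ⊗ₜ N.lsmul b n) w := by
      intro w
      induction w with
      | zero => simp
      | add x y hx hy => simp [hx, hy]
      | tmul m' n' => simp [M.innerR_rsmul_left, N.innerR_lsmul, N.mul_lsmul]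
    rw [← sub_eq_zero]
    refine P.innerR_self_eq_zero _ ?_
    change P.innerR (i (M.rsmul m b ⊗ₜ n) - i (m ⊗ₜ N.lsmul b n))
      (i (M.rsmul m b ⊗ₜ n) - i (m ⊗ₜ N.lsmul b n)) = 0
    rw [← map_sub, hR, LinearMap.map_sub₂, h, sub_self]
  · exact hl a (m ⊗ₜ n)
  · exact hr (m ⊗ₜ n) c
  · rw [N.star_innerL]
    exact hL (m ⊗ₜ n) (m' ⊗ₜ n')
  · rw [N.innerR_lsmul, star_star]
    exact hR (m ⊗ₜ n) (m' ⊗ₜ n')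
  · rw [← LinearMap.range_lift_eq_span, ht]
    exact hi

theorem isomorphic_of_span {E : Type*} [AddCommGroup E] [Module ℂ E]
    {P : HilbertBimodule.{u₁, u₂, v₁} A B} {Q : HilbertBimodule.{u₁, u₂, v₂} A B}
    (f : E →ₗ[ℂ] P) (g : E →ₗ[ℂ] Q) (hf : DenseRange f) (hg : DenseRange g) {S : Set E}
    (hS : Submodule.span ℂ S = ⊤)
    (hL : ∀ x ∈ S, ∀ y ∈ S, P.innerL (f x) (f y) = Q.innerL (g x) (g y))
    (hR : ∀ x ∈ S, ∀ y ∈ S, P.innerR (f x) (f y) = Q.innerR (g x) (g y)) : Isomorphic P Q := by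
  have hmem : ∀ x, x ∈ Submodule.span ℂ S := fun x => hS ▸ Submodule.mem_top
  refine isomorphic_of_denseRange f g hf hg (fun x y => ?_) (fun x y => ?_)
  · refine Submodule.span_induction₂ (p := fun x y _ _ => P.innerL (f x) (f y) =
      Q.innerL (g x) (g y)) (fun x y hx hy => hL x hx y hy) (by simp) (by simp) ?_ ?_ ?_ ?_
      (hmem x) (hmem y)
    all_goals simp +contextual
  · refine Submodule.span_induction₂ (p := fun x y _ _ => P.innerR (f x) (f y) =
      Q.innerR (g x) (g y)) (fun x y hx hy => hR x hx y hy) (by simp) (by simp) ?_ ?_ ?_ ?_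
      (hmem x) (hmem y)
    all_goals simp +contextual

/-- The inner products of pure tensors are prescribed by `M` and `N`, and the pure tensors span
dense subspaces; no other property is needed. -/
theorem IsInteriorTensor.unique {M : HilbertBimodule.{u₁, u₂, v₁} A B}
    {N : HilbertBimodule.{u₂, u₃, v₂} B C} {P : HilbertBimodule.{u₁, u₃, v₃} A C}
    {Q : HilbertBimodule.{u₁, u₃, v} A C} (hP : IsInteriorTensor M N P)
    (hQ : IsInteriorTensor M N Q) : Isomorphic P Q := by
  obtain ⟨s, -, -, -, sL, sR, sd⟩ := hP
  obtain ⟨t, -, -, -, tL, tR, td⟩ := hQ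
  rw [← LinearMap.range_lift_eq_span] at sd td
  refine isomorphic_of_span _ _ sd td (TensorProduct.span_tmul_eq_top ℂ M N) ?_ ?_
  · rintro _ ⟨m, n, rfl⟩ _ ⟨m', n', rfl⟩
    simp [sL, tL]
  · rintro _ ⟨m, n, rfl⟩ _ ⟨m', n', rfl⟩
    simp [sR, tR]

theorem IsInteriorTensor.congr_left {M : HilbertBimodule.{u₁, u₂, v₁} A B}
    {M' : HilbertBimodule.{u₁, u₂, v} A B}
    {N : HilbertBimodule.{u₂, u₃, v₂} B C} {P : HilbertBimodule.{u₁, u₃, v₃} A C}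
    (h : IsInteriorTensor M N P) (hM : Isomorphic M' M) : IsInteriorTensor M' N P := by
  obtain ⟨t, h1, h2, h3, h4, h5, h6⟩ := h
  obtain ⟨e, el, er, eL, eR⟩ := hM
  refine ⟨t ∘ₗ e.toLinearMap, by simp [er, h1], by simp [el, h2], by simp [h3],
    fun m n m' n' => ?_, fun m n m' n' => ?_, ?_⟩
  · simp [h4, ← er, eL]
  · simp [h5, eR]
  · convert h6 using 4
    ext x
    exact ⟨fun ⟨m, n, hx⟩ => ⟨e m, n, hx⟩, fun ⟨m, n, hx⟩ => ⟨e.symm m, n, by simp [hx]⟩⟩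

theorem IsInteriorTensor.congr_right {M : HilbertBimodule.{u₁, u₂, v₁} A B}
    {N : HilbertBimodule.{u₂, u₃, v₂} B C} {N' : HilbertBimodule.{u₂, u₃, v} B C}
    {P : HilbertBimodule.{u₁, u₃, v₃} A C}
    (h : IsInteriorTensor M N P) (hN : Isomorphic N' N) : IsInteriorTensor M N' P := by
  obtain ⟨t, h1, h2, h3, h4, h5, h6⟩ := h
  obtain ⟨e, el, er, eL, eR⟩ := hN
  refine ⟨t.compl₂ e.toLinearMap, by simp [el, h1], by simp [h2], by simp [er, h3],
    fun m n m' n' => ?_, fun m n m' n' => ?_, ?_⟩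
  · simp [h4, eL]
  · simp [h5, ← el, eR]
  · convert h6 using 4
    ext x
    exact ⟨fun ⟨m, n, hx⟩ => ⟨m, e n, hx⟩, fun ⟨m, n, hx⟩ => ⟨m, e.symm n, by simp [hx]⟩⟩

theorem IsInteriorTensor.congr {M : HilbertBimodule.{u₁, u₂, v₁} A B}
    {N : HilbertBimodule.{u₂, u₃, v₂} B C} {P : HilbertBimodule.{u₁, u₃, v₃} A C}
    {P' : HilbertBimodule.{u₁, u₃, v} A C}
    (h : IsInteriorTensor M N P) (hP : Isomorphic P P') : IsInteriorTensor M N P' := by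
  obtain ⟨t, h1, h2, h3, h4, h5, h6⟩ := h
  obtain ⟨e, el, er, eL, eR⟩ := hP
  refine ⟨t.compr₂ e.toLinearMap, by simp [h1], by simp [el, h2], by simp [er, h3],
    by simp [eL, h4], by simp [eR, h5], ?_⟩
  -- Continuity is not part of the definition of an isomorphism, but preserving the inner products
  -- implies it; it is needed to carry the dense span over to `P'`.
  have hec : Continuous e := by
    obtain ⟨C, hC, h⟩ := P.exists_normR_le
    obtain ⟨D, hD, h'⟩ := P'.exists_le_normR
    refine AddMonoidHomClass.continuous_of_bound e (D * C) fun x => (h' _).trans ?_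
    have hn : P'.toPre.normR (e x) = P.toPre.normR x :=
      congrArg (fun y => √‖y‖) (eR x x)
    rw [hn, mul_assoc]
    exact mul_le_mul_of_nonneg_left (h x) hD.le
  rw [← LinearMap.range_lift_eq_span] at h6 ⊢
  have he : ⇑(TensorProduct.lift (t.compr₂ e.toLinearMap)) = e ∘ TensorProduct.lift t := by
    have : TensorProduct.lift (t.compr₂ e.toLinearMap) = e.toLinearMap ∘ₗ TensorProduct.lift t :=
      TensorProduct.ext' (by simp)
    rw [this]
    rfl
  rw [he]
  exact e.surjective.denseRange.comp h6 hec

/-- The tensor product of dense subspaces is dense in an interior tensor product. -/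
theorem denseRange_lift_compl₁₂ {M : HilbertBimodule.{u₁, u₂, v} A B}
    {N : HilbertBimodule.{u₂, u₃, v} B C} {P : HilbertBimodule.{u₁, u₃, v₃} A C}
    {t : M →ₗ[ℂ] N →ₗ[ℂ] P}
    (tR : ∀ m n m' n',
      P.innerR (t m n) (t m' n') = N.innerR (N.lsmul (star (M.innerR m m')) n) n')
    (td : Dense (Submodule.span ℂ {x : P | ∃ m n, x = t m n} : Set P))
    {E F : Type*} [AddCommGroup E] [Module ℂ E] [AddCommGroup F] [Module ℂ F]
    {f : E →ₗ[ℂ] M} {g : F →ₗ[ℂ] N} (hf : DenseRange f) (hg : DenseRange g) :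
    DenseRange (TensorProduct.lift (t.compl₁₂ f g)) := by
  obtain ⟨C₁, hC₁, k₁⟩ := M.exists_normR_le
  obtain ⟨C₂, hC₂, k₂⟩ := N.exists_normR_le
  obtain ⟨D, hD, k⟩ := P.exists_le_normR
  -- The estimate `‖m ⊗ n‖ ≤ ‖m‖ ‖n‖` makes `t` jointly continuous, so pure tensors can be
  -- approximated factor by factor.
  have hb : ∀ m n, P.toPre.normR (t m n) ≤ M.toPre.normR m * N.toPre.normR n := fun m n => by
    refine abs_le_of_sq_le_sq' ?_
      (mul_nonneg (M.toPre.normR_nonneg m) (N.toPre.normR_nonneg n)) |>.2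
    rw [P.toPre.normR_sq]
    change ‖P.innerR (t m n) (t m n)‖ ≤ _
    rw [tR, M.star_innerR]
    calc _ ≤ N.toPre.normR (N.lsmul (M.innerR m m) n) * N.toPre.normR n :=
          N.toPre.norm_innerR_le _ _
      _ ≤ (‖M.innerR m m‖ * N.toPre.normR n) * N.toPre.normR n :=
          mul_le_mul_of_nonneg_right (N.toPre.normR_lsmul_le _ _) (N.toPre.normR_nonneg n)
      _ = _ := by rw [← M.toPre.normR_sq]; ring
  obtain ⟨t', ct, ht⟩ := LinearMap.exists_extend₂.{v} t (i := LinearMap.id) (j := LinearMap.id)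
    Function.surjective_id.denseRange Function.surjective_id.denseRange
    (C := D * C₁ * C₂) (by positivity) fun m n => calc
      ‖t m n‖ ≤ D * (M.toPre.normR m * N.toPre.normR n) :=
        (k _).trans (mul_le_mul_of_nonneg_left (hb m n) hD.le)
      _ ≤ D * ((C₁ * ‖m‖) * (C₂ * ‖n‖)) := mul_le_mul_of_nonneg_left
        (mul_le_mul (k₁ m) (k₂ n) (N.toPre.normR_nonneg n) (by positivity)) hD.le
      _ = D * C₁ * C₂ * ‖m‖ * ‖n‖ := by ring
  have hc : Continuous fun p : M × N => t p.1 p.2 :=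
    (ct continuous_fst continuous_snd).congr fun p => ht _ _
  rw [DenseRange, ← dense_closure]
  refine td.mono ?_
  have hle : Submodule.span ℂ {x : P | ∃ m n, x = t m n} ≤
      (LinearMap.range (TensorProduct.lift (t.compl₁₂ f g))).topologicalClosure := by
    rw [Submodule.span_le]
    rintro _ ⟨m, n, rfl⟩
    refine (hf.prodMap hg).induction_on (p := fun p : M × N => t p.1 p.2 ∈
      closure (Set.range (TensorProduct.lift (t.compl₁₂ f g)))) (m, n)
      (isClosed_closure.preimage hc) fun p => subset_closure ⟨p.1 ⊗ₜ p.2, ?_⟩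
    simp
  exact hle

end Interior

/-! ### Associativity -/

variable {A₁ : Type u₁} {A₂ : Type u₂} {A₃ : Type u₃} {A₄ : Type u}
  [NonUnitalCStarAlgebra A₁] [PartialOrder A₁] [StarOrderedRing A₁]
  [NonUnitalCStarAlgebra A₂] [PartialOrder A₂] [StarOrderedRing A₂]
  [NonUnitalCStarAlgebra A₃] [PartialOrder A₃] [StarOrderedRing A₃]
  [NonUnitalCStarAlgebra A₄] [PartialOrder A₄] [StarOrderedRing A₄]

/-- The interior tensor product is associative. -/
theorem IsInteriorTensor.assoc {M : HilbertBimodule.{u₁, u₂, v} A₁ A₂}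
    {N : HilbertBimodule.{u₂, u₃, v} A₂ A₃} {Q : HilbertBimodule.{u₃, u, v} A₃ A₄}
    {MN : HilbertBimodule.{u₁, u₃, v} A₁ A₃} {NQ : HilbertBimodule.{u₂, u, v} A₂ A₄}
    {P P' : HilbertBimodule.{u₁, u, v} A₁ A₄} (h₁ : IsInteriorTensor M N MN)
    (h₂ : IsInteriorTensor MN Q P) (h₃ : IsInteriorTensor N Q NQ)
    (h₄ : IsInteriorTensor M NQ P') : Isomorphic P P' := by
  obtain ⟨t₁, -, l₁, r₁, L₁, R₁, d₁⟩ := h₁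
  obtain ⟨t₂, -, l₂, r₂, L₂, R₂, d₂⟩ := h₂
  obtain ⟨t₃, -, l₃, r₃, L₃, R₃, d₃⟩ := h₃
  obtain ⟨t₄, -, l₄, r₄, L₄, R₄, d₄⟩ := h₄
  have hid : ∀ {X : Type v} [TopologicalSpace X] [AddCommGroup X] [Module ℂ X],
      DenseRange (LinearMap.id : X →ₗ[ℂ] X) := Function.surjective_id.denseRange
  rw [← LinearMap.range_lift_eq_span] at d₁ d₃
  have hf := denseRange_lift_compl₁₂ R₂ d₂ (f := TensorProduct.lift t₁) (g := LinearMap.id) d₁ hid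
  have hg := denseRange_lift_compl₁₂ R₄ d₄ (f := LinearMap.id) (g := TensorProduct.lift t₃) hid d₃
  -- Both bimodules receive the algebraic triple tensor product with dense range, so it suffices to
  -- compare inner products of pure triple tensors.
  refine isomorphic_of_span (TensorProduct.lift (t₂.compl₁₂ (TensorProduct.lift t₁) LinearMap.id))
    (TensorProduct.lift (t₄.compl₁₂ LinearMap.id (TensorProduct.lift t₃)) ∘ₗ
      (TensorProduct.assoc ℂ M N Q).toLinearMap) hf ?_
    (S := {x | ∃ m n q, (m ⊗ₜ[ℂ] n) ⊗ₜ[ℂ] q = x}) ?_ ?_ ?_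
  · rw [DenseRange, LinearMap.coe_comp, LinearEquiv.coe_coe,
      (TensorProduct.assoc ℂ M N Q).surjective.range_comp]
    exact hg
  · rw [eq_top_iff]
    rintro x -
    induction x with
    | zero => exact zero_mem _
    | add x y hx hy => exact add_mem (hx) (hy)
    | tmul w q =>
      induction w with
      | zero => simp
      | add x y hx hy => rw [TensorProduct.add_tmul]; exact add_mem hx hy
      | tmul m n => exact Submodule.subset_span ⟨m, n, q, rfl⟩
  · rintro _ ⟨m, n, q, rfl⟩ _ ⟨m', n', q', rfl⟩
    simp [L₁, L₂, L₃, L₄, ← r₁]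
  · rintro _ ⟨m, n, q, rfl⟩ _ ⟨m', n', q', rfl⟩
    simp [R₁, R₂, R₃, R₄, ← l₃]

end HilbertBimodule

/-! ### Fullness over simple algebras; unit, zero and inverses for the tensor product -/

namespace HilbertBimodule

section Ideals

variable {A : Type u₁} {B : Type u₂}
  [NonUnitalCStarAlgebra A] [PartialOrder A] [StarOrderedRing A]
  [NonUnitalCStarAlgebra B] [PartialOrder B] [StarOrderedRing B]

theorem mul_mem_leftIdeal (M : HilbertBimodule.{u₁, u₂, v} A B) (a x : A)
    (hx : x ∈ M.leftIdeal) : a * x ∈ M.leftIdeal ∧ x * a ∈ M.leftIdeal := by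
  constructor
  · refine map_mem_closure (continuous_const_mul a) hx fun y hy => ?_
    refine Submodule.span_induction (p := fun y _ => a * y ∈ Submodule.span ℂ _) ?_ (by simp)
      (fun y z _ _ hy hz => by rw [mul_add]; exact add_mem hy hz)
      (fun c y _ hy => by rw [mul_smul_comm]; exact Submodule.smul_mem _ c hy) hy
    rintro _ ⟨m, n, rfl⟩
    exact Submodule.subset_span ⟨M.lsmul a m, n, (M.innerL_lsmul a m n).symm⟩
  · refine map_mem_closure (f := (· * a)) (continuous_mul_const a) hx fun y hy => ?_
    refine Submodule.span_induction (p := fun y _ => y * a ∈ Submodule.span ℂ _) ?_ (by simp)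
      (fun y z _ _ hy hz => by rw [add_mul]; exact add_mem hy hz)
      (fun c y _ hy => by rw [smul_mul_assoc]; exact Submodule.smul_mem _ c hy) hy
    rintro _ ⟨m, n, rfl⟩
    exact Submodule.subset_span ⟨m, M.lsmul (star a) n, by rw [M.innerL_lsmul_right, star_star]⟩

/-- The closed ideal contains `⟨m, m⟩`, which is nonzero for `m ≠ 0`, so simplicity leaves only the
whole algebra. -/
theorem leftIdeal_eq_top (hA : IsSimpleCStarAlgebra A) (M : HilbertBimodule.{u₁, u₂, v} A B)
    (hM : Nontrivial M) : M.leftIdeal = ⊤ := by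
  refine (hA.eq_bot_or_eq_top M.leftIdeal (Submodule.isClosed_topologicalClosure _)
    M.mul_mem_leftIdeal).resolve_left fun h => ?_
  obtain ⟨m, hm⟩ := exists_ne (0 : M)
  refine hm (M.innerL_self_eq_zero m ?_)
  rw [← Submodule.mem_bot ℂ, ← h]
  exact Submodule.le_topologicalClosure _ (Submodule.subset_span ⟨m, m, rfl⟩)

theorem isImprimitivity_of_nontrivial (hA : IsSimpleCStarAlgebra A) (hB : IsSimpleCStarAlgebra B)
    (M : HilbertBimodule.{u₁, u₂, v} A B) (hM : Nontrivial M) : M.IsImprimitivity :=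
  -- The right ideal of `M` is by definition the left ideal of its conjugate.
  ⟨M.leftIdeal_eq_top hA hM, M.dual.leftIdeal_eq_top hB hM⟩

theorem isomorphic_dual_dual (M : HilbertBimodule.{u₁, u₂, v} A B) :
    Isomorphic M M.dual.dual := by
  let e : M ≃ₗ[ℂ] ConjSpace (ConjSpace M) := ConjSpace.of.trans ConjSpace.of
  refine ⟨e, fun a m => ?_, fun m b => ?_, fun m m' => rfl, fun m m' => rfl⟩
  · conv_lhs => rw [← star_star a]
    rfl
  · conv_lhs => rw [← star_star b]
    rfl

end Ideals

variable {A : Type u} [NonUnitalCStarAlgebra A] [PartialOrder A] [StarOrderedRing A]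

/-- The tensor map is the action itself, `a ⊗ m ↦ a m`; density of its span is nondegeneracy. -/
theorem isInteriorTensor_unit_left (M : HilbertBimodule.{u, u, v} A A) :
    IsInteriorTensor (unitBimodule A) M M := by
  refine ⟨M.lsmul, M.mul_lsmul, M.mul_lsmul, fun m n c => (M.lsmul_rsmul m n c).symm,
    fun (m : A) n (m' : A) n' => ?_, fun (m : A) n (m' : A) n' => ?_, M.lsmul_dense⟩
  · change M.innerL (M.lsmul m n) (M.lsmul m' n') = m * star (m' * star (M.innerL n n'))
    rw [M.innerL_lsmul, M.innerL_lsmul_right, star_mul, star_star]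
  · change M.innerR (M.lsmul m n) (M.lsmul m' n') = M.innerR (M.lsmul (star (star m * m')) n) n'
    rw [M.innerR_lsmul, M.innerR_lsmul, ← M.mul_lsmul, star_star]

theorem isInteriorTensor_unit_right (M : HilbertBimodule.{u, u, v} A A) :
    IsInteriorTensor M (unitBimodule A) M := by
  refine ⟨M.rsmul, fun m b c => (M.rsmul_mul m b c).symm, M.lsmul_rsmul, M.rsmul_mul,
    fun m (n : A) m' (n' : A) => ?_, fun m (n : A) m' (n' : A) => ?_, M.rsmul_dense⟩
  · change M.innerL (M.rsmul m n) (M.rsmul m' n') = M.innerL m (M.rsmul m' (star (n * star n')))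
    rw [M.innerL_rsmul, ← M.rsmul_mul, star_mul, star_star]
  · change M.innerR (M.rsmul m n) (M.rsmul m' n') = star (star (M.innerR m m') * n) * n'
    rw [M.innerR_rsmul, M.innerR_rsmul_left, star_mul, star_star]

theorem isInteriorTensor_zero_left (M : HilbertBimodule.{u, u, v} A A) :
    IsInteriorTensor (zeroBimodule A) M (zeroBimodule A) :=
  ⟨0, by simp, by simp, by simp, fun m n m' n' => rfl,
    fun m n m' n' => by
      change (0 : A) = M.innerR (M.lsmul (star 0) n) n'
      simp,
    fun x => subset_closure (Subsingleton.elim (α := PUnit) 0 x ▸ zero_mem (Submodule.span ℂ _))⟩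

theorem isInteriorTensor_zero_right (M : HilbertBimodule.{u, u, v} A A) :
    IsInteriorTensor M (zeroBimodule A) (zeroBimodule A) :=
  ⟨0, by simp, by simp, by simp, fun m n m' n' => by
      change (0 : A) = M.innerL m (M.rsmul m' (star 0))
      simp,
    fun m n m' n' => rfl,
    fun x => subset_closure (Subsingleton.elim (α := PUnit) 0 x ▸ zero_mem (Submodule.span ℂ _))⟩

/-- The tensor map is `m ⊗ n ↦ _A⟨m, n⟩`. Both inner product formulas come from `_A⟨m, n⟩ r = m ⟨n,
r⟩_A`, and density of the span is left fullness. -/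
theorem isInteriorTensor_dual_right (M : HilbertBimodule.{u, u, v} A A) (hM : M.leftIdeal = ⊤) :
    IsInteriorTensor M M.dual (unitBimodule A) := by
  let t : M →ₗ[ℂ] ConjSpace M →ₗ[ℂ] A := LinearMap.mk₂ ℂ
    (fun m n => M.innerL m (ConjSpace.of.symm n)) (by simp) (by simp) (by simp) (by simp)
  refine ⟨t, fun m b n => M.innerL_rsmul m (ConjSpace.of.symm n) b,
    fun a m n => M.innerL_lsmul a m (ConjSpace.of.symm n),
    fun m n c => (M.innerL_lsmul_right (star c) m (ConjSpace.of.symm n)).trans (by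
      rw [star_star]; rfl), fun m n m' n' => ?_, fun m n m' n' => ?_, ?_⟩
  · change M.innerL m (ConjSpace.of.symm n) * star (M.innerL m' (ConjSpace.of.symm n')) =
      M.innerL m (M.rsmul m' (star (M.innerR (ConjSpace.of.symm n) (ConjSpace.of.symm n'))))
    rw [M.star_innerR, ← M.innerL_assoc, M.innerL_lsmul_right]
  · change star (M.innerL m (ConjSpace.of.symm n)) * M.innerL m' (ConjSpace.of.symm n') =
      M.innerL (M.rsmul (ConjSpace.of.symm n) (star (star (M.innerR m m')))) (ConjSpace.of.symm n')
    rw [star_star, ← M.innerL_assoc, M.innerL_lsmul, M.star_innerL]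
  · exact Submodule.dense_iff_topologicalClosure_eq_top.mpr hM

theorem isInteriorTensor_dual_left (M : HilbertBimodule.{u, u, v} A A) (hM : M.rightIdeal = ⊤) :
    IsInteriorTensor M.dual M (unitBimodule A) :=
  (M.dual.isInteriorTensor_dual_right hM).congr_right M.isomorphic_dual_dual

/-! ### The monoid of isomorphism classes -/

theorem isoClass_eq_iff {M N : HilbertBimodule.{u, u, u} A A} :
    isoClass M = isoClass N ↔ Isomorphic M N := Quotient.eq

theorem IsInteriorTensor.congr_of_isomorphic {M M' N N' P P' : HilbertBimodule.{u, u, u} A A}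
    (h : IsInteriorTensor M N P) (h' : IsInteriorTensor M' N' P') (hM : Isomorphic M M')
    (hN : Isomorphic N N') : Isomorphic P P' :=
  h.unique ((h'.congr_left hM).congr_right hN)

/-- The multiplication of isomorphism classes by the interior tensor product. -/
noncomputable abbrev isoClassMul : Mul (IsoClass A) where
  mul := Quotient.map₂ (fun M N => Classical.choose (M.exists_isInteriorTensor N))
    fun M M' hM N N' hN =>
      (Classical.choose_spec (M.exists_isInteriorTensor N)).congr_of_isomorphic
        (Classical.choose_spec (M'.exists_isInteriorTensor N')) hM hN

attribute [local instance] isoClassMul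

theorem isoClass_mul_eq_iff {M N P : HilbertBimodule.{u, u, u} A A} :
    isoClass M * isoClass N = isoClass P ↔ IsInteriorTensor M N P := by
  have h := Classical.choose_spec (M.exists_isInteriorTensor N)
  refine Iff.trans (b := Isomorphic (Classical.choose (M.exists_isInteriorTensor N)) P)
    Quotient.eq ⟨h.congr, h.unique⟩

/-- The interior tensor product makes the isomorphism classes of bimodules a monoid with zero. -/
noncomputable abbrev isoClassMonoidWithZero : MonoidWithZero (IsoClass A) where
  mul_assoc := by
    rintro ⟨M⟩ ⟨N⟩ ⟨P⟩
    obtain ⟨MN, h₁⟩ := M.exists_isInteriorTensor N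
    obtain ⟨Q, h₂⟩ := MN.exists_isInteriorTensor P
    obtain ⟨NP, h₃⟩ := N.exists_isInteriorTensor P
    obtain ⟨Q', h₄⟩ := M.exists_isInteriorTensor NP
    change isoClass M * isoClass N * isoClass P = isoClass M * (isoClass N * isoClass P)
    rw [isoClass_mul_eq_iff.mpr h₁, isoClass_mul_eq_iff.mpr h₂, isoClass_mul_eq_iff.mpr h₃,
      isoClass_mul_eq_iff.mpr h₄, isoClass_eq_iff]
    exact h₁.assoc h₂ h₃ h₄
  one := isoClass (unitBimodule A)
  one_mul := by
    rintro ⟨M⟩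
    exact isoClass_mul_eq_iff.mpr M.isInteriorTensor_unit_left
  mul_one := by
    rintro ⟨M⟩
    exact isoClass_mul_eq_iff.mpr M.isInteriorTensor_unit_right
  zero := isoClass (zeroBimodule A)
  zero_mul := by
    rintro ⟨M⟩
    exact isoClass_mul_eq_iff.mpr M.isInteriorTensor_zero_left
  mul_zero := by
    rintro ⟨M⟩
    exact isoClass_mul_eq_iff.mpr M.isInteriorTensor_zero_right

attribute [local instance] isoClassMonoidWithZero

theorem isoClass_ne_zero_iff {M : HilbertBimodule.{u, u, u} A A} :
    isoClass M ≠ 0 ↔ Nontrivial M := by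
  rw [← not_subsingleton_iff_nontrivial, not_iff_not]
  refine (isoClass_eq_iff (N := zeroBimodule A)).trans ⟨fun ⟨e, _⟩ => ?_, fun h => ?_⟩
  · exact (e.toEquiv.trans (Equiv.refl PUnit.{u + 1})).subsingleton
  · refine ⟨LinearEquiv.ofBijective (0 : M →ₗ[ℂ] PUnit.{u + 1})
      ⟨fun x y _ => Subsingleton.elim x y, fun x => ⟨0, rfl⟩⟩, fun a m => rfl, fun m b => rfl,
      fun m m' => ?_, fun m m' => ?_⟩
    · change (0 : A) = M.innerL m m'
      rw [Subsingleton.elim m 0, map_zero, LinearMap.zero_apply]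
    · change (0 : A) = M.innerR m m'
      rw [Subsingleton.elim m 0, map_zero, LinearMap.zero_apply]

/-! ### The Picard group of a simple algebra -/

section Simple

theorem exists_isImprimitivity_iff (hA : IsSimpleCStarAlgebra A) (x : IsoClass A) :
    (∃ M : HilbertBimodule.{u, u, u} A A, M.IsImprimitivity ∧ isoClass M = x) ↔ x ≠ 0 := by
  constructor
  · rintro ⟨M, hM, rfl⟩
    rw [isoClass_ne_zero_iff, ← not_subsingleton_iff_nontrivial]
    intro hs
    have : M.leftIdeal = ⊥ := by
      rw [leftIdeal, Submodule.span_eq_bot.mpr,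
        IsClosed.submodule_topologicalClosure_eq isClosed_singleton]
      rintro _ ⟨m, n, rfl⟩
      rw [Subsingleton.elim m 0, map_zero, LinearMap.zero_apply]
    have := hA.nontrivial
    exact bot_ne_top (α := Submodule ℂ A) (by rw [← hM.1, ‹M.leftIdeal = ⊥›])
  · obtain ⟨M⟩ := x
    exact fun h => ⟨M, M.isImprimitivity_of_nontrivial hA hA (isoClass_ne_zero_iff.mp h), rfl⟩

/-- The inverse is the class of the conjugate bimodule, by right fullness. -/
theorem exists_inverse (hA : IsSimpleCStarAlgebra A) {x : IsoClass A} (hx : x ≠ 0) :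
    ∃ y, y ≠ 0 ∧ y * x = 1 := by
  obtain ⟨M, hM, rfl⟩ := (exists_isImprimitivity_iff hA x).mpr hx
  refine ⟨isoClass M.dual, isoClass_ne_zero_iff.mpr
    (show Nontrivial M from isoClass_ne_zero_iff.mp hx), ?_⟩
  exact isoClass_mul_eq_iff.mpr (M.isInteriorTensor_dual_left hM.2)

theorem isoClass_one_ne_zero (hA : IsSimpleCStarAlgebra A) : (1 : IsoClass A) ≠ 0 :=
  isoClass_ne_zero_iff.mpr hA.nontrivial

theorem isoClass_mul_ne_zero (hA : IsSimpleCStarAlgebra A) {x y : IsoClass A} (hx : x ≠ 0)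
    (hy : y ≠ 0) : x * y ≠ 0 := by
  obtain ⟨z, -, hz⟩ := exists_inverse hA hx
  intro h
  apply hy
  rw [← one_mul y, ← hz, mul_assoc, h, mul_zero]

/-- The Picard group of a simple `C*`-algebra. -/
noncomputable abbrev picGroup (hA : IsSimpleCStarAlgebra A) : Group (Pic A) :=
  letI : Mul (Pic A) := ⟨fun x y => ⟨x.1 * y.1, (exists_isImprimitivity_iff hA _).mpr
    (isoClass_mul_ne_zero hA ((exists_isImprimitivity_iff hA _).mp x.2)
      ((exists_isImprimitivity_iff hA _).mp y.2))⟩⟩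
  letI : One (Pic A) := ⟨⟨1, (exists_isImprimitivity_iff hA _).mpr (isoClass_one_ne_zero hA)⟩⟩
  have h (x : Pic A) := exists_inverse hA ((exists_isImprimitivity_iff hA _).mp x.2)
  letI : Inv (Pic A) := ⟨fun x => ⟨Classical.choose (h x), (exists_isImprimitivity_iff hA _).mpr
    (Classical.choose_spec (h x)).1⟩⟩
  -- A left unit and left inverses suffice for a group, so right inverses need no separate argument.
  Group.ofLeftAxioms (fun x y z => Subtype.ext (mul_assoc x.1 y.1 z.1))
    (fun x => Subtype.ext (one_mul x.1)) fun x => Subtype.ext (Classical.choose_spec (h x)).2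

end Simple

end HilbertBimodule

theorem mainTheorem5 (A : Type u) [NonUnitalCStarAlgebra A] [PartialOrder A] [StarOrderedRing A]
    (hA : IsSimpleCStarAlgebra A) :
    (∀ M : HilbertBimodule.{u, u, v} A A, Nontrivial M → M.IsImprimitivity) ∧
    ∃ (_ : MonoidWithZero (HilbertBimodule.IsoClass A)) (_ : Group (HilbertBimodule.Pic A)),
      (∀ M N P : HilbertBimodule.{u, u, u} A A,
        HilbertBimodule.isoClass M * HilbertBimodule.isoClass N = HilbertBimodule.isoClass P ↔
          HilbertBimodule.IsInteriorTensor M N P) ∧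
      HilbertBimodule.isoClass (HilbertBimodule.zeroBimodule A) = 0 ∧
      HilbertBimodule.isoClass (HilbertBimodule.unitBimodule A) = 1 ∧
      (∀ p q : HilbertBimodule.Pic A, (p * q).1 = p.1 * q.1) ∧
      ∃ e : WithZero (HilbertBimodule.Pic A) ≃* HilbertBimodule.IsoClass A,
        e 0 = 0 ∧ ∀ p : HilbertBimodule.Pic A, e (p : WithZero (HilbertBimodule.Pic A)) = p.1 := by
  let := HilbertBimodule.isoClassMonoidWithZero (A := A)
  let := HilbertBimodule.picGroup hA
  let i : HilbertBimodule.Pic A →* HilbertBimodule.IsoClass A :=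
    { toFun := Subtype.val, map_one' := rfl, map_mul' := fun _ _ => rfl }
  have ne : ∀ p : HilbertBimodule.Pic A, p.1 ≠ 0 := fun p =>
    (HilbertBimodule.exists_isImprimitivity_iff hA _).mp p.2
  refine ⟨fun M => M.isImprimitivity_of_nontrivial hA hA, HilbertBimodule.isoClassMonoidWithZero,
    HilbertBimodule.picGroup hA,
    fun M N P => HilbertBimodule.isoClass_mul_eq_iff, rfl, rfl, fun _ _ => rfl,
    -- Injectivity holds because no class in `Pic A` is zero, surjectivity because every nonzero
    -- class lies in `Pic A`.
    MulEquiv.ofBijective (WithZero.lift' i) ⟨?_, ?_⟩, map_zero (WithZero.lift' i),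
    fun p => WithZero.lift'_coe i p⟩
  · intro x y h
    induction x using WithZero.recZeroCoe with
    | zero =>
      induction y using WithZero.recZeroCoe with
      | zero => rfl
      | coe q =>
        rw [map_zero, WithZero.lift'_coe] at h
        exact (ne q h.symm).elim
    | coe p =>
      induction y using WithZero.recZeroCoe with
      | zero =>
        rw [map_zero, WithZero.lift'_coe] at h
        exact (ne p h).elim
      | coe q =>
        rw [WithZero.lift'_coe, WithZero.lift'_coe] at h
        exact congrArg _ (Subtype.ext h)
  · intro x
    by_cases hx : x = 0
    · exact ⟨0, by rw [map_zero, hx]⟩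
    · let p : HilbertBimodule.Pic A := ⟨x, (HilbertBimodule.exists_isImprimitivity_iff hA x).mpr hx⟩
      exact ⟨(p : WithZero (HilbertBimodule.Pic A)), WithZero.lift'_coe i p⟩
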